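/- Let $\Omega\subseteq\mathbb C$ be a simply connected domain and let $\mu:\Omega\to\mathbb C$ be piecewise continuous (up to a Lebesgue-null set, $\Omega$ is a disjoint union of open pieces on each of which $\mu$ is continuous) with $\|\mu\|_{L^\infty(\Omega)}<1$. A function $f:\Omega\to\mathbb C$ is called a solution of the Beltrami equation with coefficient $\mu$ if $f\in W^{1,2}_{\mathrm{loc}}(\Omega)$ and its weak derivatives satisfy $\partial_{\bar z}f=\mu\,\partial_z f$ almost everywhere in $\Omega$. Let $\varphi_0:\Omega\to\mathbb C$ be a continuous injective (that is, quasiconformal) solution of this equation, and let $\varphi:\Omega\to\mathbb C$ be continuous and injective. For a Jordan curve $\gamma:[0,1]\to\Omega$, let $\oint_\gamma\varphi\,d\varphi_0$ denote the Riemann–Stieltjes integral $\int_0^1\varphi(\gamma(t))\,d(\varphi_0(\gamma(t)))$ (the limit of tagged-partition sums as the mesh tends to $0$), when it exists. Then the following are equivalent: 1. $\varphi$ is a solution of the Beltrami equation with coefficient $\mu$; 2. for every Jordan curve $\gamma$ in $\Omega$ such that $\varphi_0\circ\gamma$ is rectifiable, $\oint_\gamma\varphi\,d\varphi_0$ exists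 and equals $0$; 3. for every Jordan curve $\gamma$ in $\Omega$ for which $\oint_\gamma\varphi\,d\varphi_0$ exists, it equals $0$. Moreover, $$\oint_\gamma\varphi\,d\varphi_0=\oint_\gamma\varphi(z)\,\partial_z\varphi_0(z)\,[dz+\mu(z)\,d\bar z]$$ for every Jordan curve $\gamma$ in $\Omega$ along which the right-hand side makes sense, that is, such that $\gamma$ and $\varphi_0\circ\gamma$ are absolutely continuous and, for almost every $t\in[0,1]$, $\varphi_0$ is real-differentiable at $\gamma(t)$ with $\partial_{\bar z}\varphi_0(\gamma(t))=\mu(\gamma(t))\,\partial_z\varphi_0(\gamma(t))$; both integrals then exist. -/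

import Mathlib

open MeasureTheory Set

noncomputable section

/-- The Wirtinger derivative `∂f/∂z = (∂f/∂x - i ∂f/∂y) / 2`. -/
def dz (f : ℂ → ℂ) (z : ℂ) : ℂ :=
  (fderiv ℝ f z 1 - Complex.I * fderiv ℝ f z Complex.I) / 2

/-- The Wirtinger derivative `∂f/∂z̄ = (∂f/∂x + i ∂f/∂y) / 2`. -/
def dzbar (f : ℂ → ℂ) (z : ℂ) : ℂ :=
  (fderiv ℝ f z 1 + Complex.I * fderiv ℝ f z Complex.I) / 2

/-- Test functions on `Ω`: smooth functions with compact support contained in `Ω`. -/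
def IsTestFunction (Ω : Set ℂ) (ψ : ℂ → ℂ) : Prop :=
  ContDiff ℝ ((⊤ : ℕ∞) : WithTop ℕ∞) ψ ∧ HasCompactSupport ψ ∧ tsupport ψ ⊆ Ω

/-- `g` belongs to `L²_loc(Ω)`. -/
def MemL2Loc (Ω : Set ℂ) (g : ℂ → ℂ) : Prop :=
  ∀ K : Set ℂ, IsCompact K → K ⊆ Ω → MemLp g 2 (volume.restrict K)

/-- `p` is the weak (distributional) derivative `∂f/∂z` on `Ω`. -/
def IsWeakDz (Ω : Set ℂ) (f p : ℂ → ℂ) : Prop :=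
  ∀ ψ : ℂ → ℂ, IsTestFunction Ω ψ → ∫ z in Ω, f z * dz ψ z = - ∫ z in Ω, p z * ψ z

/-- `q` is the weak (distributional) derivative `∂f/∂z̄` on `Ω`. -/
def IsWeakDzbar (Ω : Set ℂ) (f q : ℂ → ℂ) : Prop :=
  ∀ ψ : ℂ → ℂ, IsTestFunction Ω ψ → ∫ z in Ω, f z * dzbar ψ z = - ∫ z in Ω, q z * ψ z

/-- `f` is a solution on `Ω` of the Beltrami equation `∂f/∂z̄ = μ ∂f/∂z`: it lies in the Sobolev
space `W^{1,2}_loc(Ω)` and its weak derivatives satisfy the equation almost everywhere in `Ω`. -/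
def IsBeltramiSolution (Ω : Set ℂ) (μ f : ℂ → ℂ) : Prop :=
  MemL2Loc Ω f ∧ ∃ p q : ℂ → ℂ, MemL2Loc Ω p ∧ MemL2Loc Ω q ∧
    IsWeakDz Ω f p ∧ IsWeakDzbar Ω f q ∧ ∀ᵐ z ∂(volume.restrict Ω), q z = μ z * p z

/-- `μ` is piecewise continuous on `Ω`: up to a null set, `Ω` is a disjoint union of open pieces
on each of which `μ` is continuous. No regularity of the boundaries of the pieces, no finiteness
and no one-sided limits are required, so that this is implied by the more restrictive variants. -/
def IsPiecewiseContinuousOn (μ : ℂ → ℂ) (Ω : Set ℂ) : Prop :=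
  ∃ P : Set (Set ℂ), (∀ U ∈ P, IsOpen U ∧ U ⊆ Ω ∧ ContinuousOn μ U) ∧
    P.PairwiseDisjoint id ∧ volume (Ω \ ⋃₀ P) = 0

/-- `γ`, restricted to `[0, 1]`, parametrizes a Jordan curve (simple closed curve) in `Ω`. -/
def IsJordanCurveIn (γ : ℝ → ℂ) (Ω : Set ℂ) : Prop :=
  ContinuousOn γ (Icc 0 1) ∧ γ 0 = γ 1 ∧ InjOn γ (Ico 0 1) ∧ MapsTo γ (Icc 0 1) Ω

/-- The contour integral `∮_γ f dg` exists and equals `I`, as a Riemann-Stieltjes integral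
`∫₀¹ f(γ(t)) d(g(γ(t)))`: the sums over tagged partitions `0 = t₀ ≤ s₀ ≤ t₁ ≤ ... ≤ tₙ = 1`
converge to `I` as the mesh of the partition tends to `0`. -/
def HasContourIntegral (f g : ℂ → ℂ) (γ : ℝ → ℂ) (I : ℂ) : Prop :=
  ∀ ε : ℝ, 0 < ε → ∃ δ : ℝ, 0 < δ ∧ ∀ (n : ℕ) (t s : ℕ → ℝ), t 0 = 0 → t n = 1 →
    (∀ i < n, s i ∈ Icc (t i) (t (i + 1)) ∧ t (i + 1) - t i < δ) →
    ‖(∑ i ∈ Finset.range n, f (γ (s i)) * (g (γ (t (i + 1))) - g (γ (t i)))) - I‖ < ε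

end

/-!
Let `φ₀` be the injective solution and `φ` a continuous solution. The mollification of `φ ∘ φ₀⁻¹`
can be written, without inverting `φ₀`, as an integral over a disc in `Ω` weighted by the Jacobian
`|∂φ₀/∂z|² - |∂φ₀/∂z̄|²`. It is holomorphic: the weak derivatives of `φ₀` commute when tested
against a localization of `φ · (η ∘ φ₀)`, and the terms with derivatives of `φ` cancel because both
functions solve the same equation. For `φ = 1` the mollification is moreover real, hence constant,
and it is positive at the centre, so `φ₀` is an open map. Letting the mollification parameter tend
to zero, `h = φ ∘ φ₀⁻¹` is holomorphic (Stoilow factorization).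

The contour integral is now the Stieltjes integral of `h` along `Γ = φ₀ ∘ γ`, and `h` has a
primitive `H` on the simply connected set `φ₀(Ω)`. If `Γ` is rectifiable, the partition sums
approach the telescoping sum of the increments of `H`. If `Γ` is arbitrary but the integral exists,
moving the tags bounds `∑ |Δφ| |Δφ₀|` over fine partitions; since `φ` is injective, `h' ≠ 0`, and
this sum controls the difference between `h(Γ) ΔΓ` and `ΔH`.

Conversely, the vanishing of the integrals along the curves that `φ₀` maps to boundaries of
rectangles makes `h` holomorphic by Morera's theorem, and a holomorphic function of a solution is a
solution.
-/

open Filter Topology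
open scoped ComplexConjugate ContDiff ENNReal NNReal

/-! ### Primitives on simply connected domains -/

/-- The fibre bundle with discrete fibre `A` whose sections are the functions on `X` differing
locally by constants from the functions `H i` on `U i`: the point `a` of the fibre over `x`, read
in the chart `i`, stands for a function with the value `H i x + a` at `x`. -/
@[reducible]
def localConstantsCore {X A : Type*} [TopologicalSpace X] [AddCommGroup A] [TopologicalSpace A]
    [DiscreteTopology A] (U : X → Set X) (hU : ∀ i, IsOpen (U i)) (hmem : ∀ i, i ∈ U i)
    (H : X → X → A)
    (hH : ∀ i j, ∀ x ∈ U i ∩ U j, ∀ᶠ y in 𝓝 x, H i y - H j y = H i x - H j x) :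
    FiberBundleCore X X A where
  baseSet := U
  isOpen_baseSet := hU
  indexAt := id
  mem_baseSet_at := hmem
  coordChange i j x a := a + (H i x - H j x)
  coordChange_self i x _ a := by simp
  continuousOn_coordChange i j := by
    refine continuousOn_snd.add fun p hp => ContinuousAt.continuousWithinAt ?_
    exact continuousAt_const.congr
      (((hH i j p.1 hp.1).mono fun _ hy => hy.symm).filter_mono continuousAt_fst)
  coordChange_comp i j k x _ a := by abel

theorem exists_eventually_sub_eq_sub {X A : Type*} [TopologicalSpace X] [SimplyConnectedSpace X]
    [LocallyPathConnectedSpace X] [AddCommGroup A] {U : X → Set X} (hU : ∀ i, IsOpen (U i))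
    (hmem : ∀ i, i ∈ U i) {H : X → X → A}
    (hH : ∀ i j, ∀ x ∈ U i ∩ U j, ∀ᶠ y in 𝓝 x, H i y - H j y = H i x - H j x) :
    ∃ G : X → A, ∀ x, ∀ᶠ y in 𝓝 x, G y - H x y = G x - H x x := by
  let : TopologicalSpace A := ⊥
  have : DiscreteTopology A := ⟨rfl⟩
  let Z := localConstantsCore U hU hmem H hH
  have hcov : IsCoveringMap Z.proj := FiberBundle.isCoveringMap (F := A) (E := Z.Fiber)
  obtain ⟨x₀⟩ := (inferInstance : Nonempty X)
  obtain ⟨σ, ⟨-, hσ⟩, -⟩ :=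
    hcov.existsUnique_continuousMap_lifts (.id X) (a₀ := x₀) (e₀ := ⟨x₀, (0 : A)⟩) rfl
  obtain ⟨a, ha⟩ : ∃ a : X → A, ∀ x, σ x = ⟨x, a x⟩ := by
    have hfib (x : X) : ∃ b : A, σ x = ⟨x, b⟩ := by
      rcases hx : σ x with ⟨y, b⟩
      obtain rfl : y = x := by simpa [hx] using congr_fun hσ x
      exact ⟨b, rfl⟩
    exact Classical.axiomOfChoice hfib
  refine ⟨fun x => a x + H x x, fun x => ?_⟩
  have hc : ContinuousAt (fun y => (Z.localTriv x (σ y)).2) x := by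
    refine continuousAt_snd.comp (((Z.localTriv x).continuousAt ?_).comp σ.continuous.continuousAt)
    rw [Z.mem_localTriv_source, ha]
    exact hmem x
  have hval (y : X) : (Z.localTriv x (σ y)).2 = a y + H y y - H x y := by
    simp [ha, Z, add_sub_assoc]
  have := hc.eventually_mem ((isOpen_discrete {(Z.localTriv x (σ x)).2}).mem_nhds rfl)
  simpa only [hval, mem_singleton_iff] using this

section
variable {E : Type*} [NormedAddCommGroup E] [NormedSpace ℂ E]

theorem eventually_sub_eq_sub_of_hasDerivAt {h H K : ℂ → E} {x : ℂ}
    (hH : ∀ᶠ z in 𝓝 x, HasDerivAt H (h z) z) (hK : ∀ᶠ z in 𝓝 x, HasDerivAt K (h z) z) :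
    ∀ᶠ y in 𝓝 x, H y - K y = H x - K x := by
  obtain ⟨r, hr, hball⟩ := Metric.eventually_nhds_iff_ball.1 (hH.and hK)
  have hd (z : ℂ) (hz : z ∈ Metric.ball x r) : HasDerivAt (H - K) 0 z := by
    simpa using (hball z hz).1.sub (hball z hz).2
  filter_upwards [Metric.ball_mem_nhds x hr] with y hy
  exact Metric.isOpen_ball.is_const_of_deriv_eq_zero (convex_ball x r).isPreconnected
    (fun z hz => (hd z hz).differentiableAt.differentiableWithinAt)
    (fun z hz => (hd z hz).deriv) hy (Metric.mem_ball_self hr)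

theorem isExactOn_of_isSimplyConnected [CompleteSpace E] {V : Set ℂ} (hVo : IsOpen V)
    (hV : IsSimplyConnected V) {h : ℂ → E} (hh : DifferentiableOn ℂ h V) :
    Complex.IsExactOn h V := by
  have := hV.simplyConnectedSpace
  have := hVo.locallyPathConnectedSpace
  choose r hr hrV using fun x : V => Metric.isOpen_iff.1 hVo x x.2
  choose H hH using fun x : V => (hh.mono (hrV x)).isExactOn_ball
  have hHev (i : V) {z : ℂ} (hz : z ∈ Metric.ball (i : ℂ) (r i)) :
      ∀ᶠ w in 𝓝 z, HasDerivAt (H i) (h w) w :=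
    Filter.mem_of_superset (Metric.isOpen_ball.mem_nhds hz) (hH i)
  obtain ⟨G, hG⟩ := exists_eventually_sub_eq_sub (H := fun i x : V => H i x)
    (fun i => Metric.isOpen_ball) (fun i => Metric.mem_ball_self (hr i))
    fun i j x hx => continuousAt_subtype_val.eventually
      (eventually_sub_eq_sub_of_hasDerivAt (hHev i hx.1) (hHev j hx.2))
  refine ⟨Function.extend (Subtype.val : V → ℂ) G 0, fun z hz => ?_⟩
  have hloc : ∀ᶠ w in 𝓝 z, Function.extend (Subtype.val : V → ℂ) G 0 w =
      H ⟨z, hz⟩ w + (G ⟨z, hz⟩ - H ⟨z, hz⟩ z) := by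
    rw [← hVo.isOpenEmbedding_subtypeVal.map_nhds_eq ⟨z, hz⟩, eventually_map]
    filter_upwards [hG ⟨z, hz⟩] with w hw
    rw [Subtype.val_injective.extend_apply, ← hw, add_sub_cancel]
  exact ((hH ⟨z, hz⟩ z (Metric.mem_ball_self (hr _))).add_const _).congr_of_eventuallyEq hloc
end

theorem exists_openPartialHomeomorph_of_injOn {X Y : Type*} [TopologicalSpace X]
    [TopologicalSpace Y] [Nonempty X] {f : X → Y} {s : Set X} (hf : ContinuousOn f s)
    (hi : InjOn f s) (hs : IsOpen s) (hmap : ∀ x ∈ s, 𝓝 (f x) ≤ map f (𝓝 x)) :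
    ∃ e : OpenPartialHomeomorph X Y, ⇑e = f ∧ e.source = s := by
  refine ⟨.ofContinuousOpenRestrict (hi.toPartialEquiv f s) hf ?_ hs, rfl, rfl⟩
  refine IsOpenMap.of_nhds_le fun x => ?_
  have := hmap x x.2
  rwa [← hs.isOpenEmbedding_subtypeVal.map_nhds_eq x, map_map] at this

theorem not_eventually_eq_of_injOn {X Y : Type*} [TopologicalSpace X] {f : X → Y} {s : Set X}
    (hi : InjOn f s) {x : X} [(𝓝[≠] x).NeBot] (hs : s ∈ 𝓝 x) : ¬∀ᶠ y in 𝓝 x, f y = f x := by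
  intro h
  have hne : ∀ᶠ _ in 𝓝[≠] x, False := by
    filter_upwards [self_mem_nhdsWithin, h.filter_mono nhdsWithin_le_nhds,
      mem_nhdsWithin_of_mem_nhds hs] with _ hy hyx hys
    exact hy (hi hys (mem_of_mem_nhds hs) hyx)
  exact hne.exists.choose_spec

theorem exists_openPartialHomeomorph_of_differentiableOn {V : Set ℂ} (hV : IsOpen V)
    {h : ℂ → ℂ} (hh : DifferentiableOn ℂ h V) (hi : InjOn h V) :
    ∃ e : OpenPartialHomeomorph ℂ ℂ, ⇑e = h ∧ e.source = V :=
  exists_openPartialHomeomorph_of_injOn hh.continuousOn hi hV fun _ hx =>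
    (hh.analyticAt (hV.mem_nhds hx)).eventually_constant_or_nhds_le_map_nhds.resolve_left
      (not_eventually_eq_of_injOn hi (hV.mem_nhds hx))

theorem eventually_deriv_ne_zero_of_injOn {V : Set ℂ} (hV : IsOpen V) {h : ℂ → ℂ}
    (hh : DifferentiableOn ℂ h V) (hi : InjOn h V) {w : ℂ} (hw : w ∈ V) :
    ∀ᶠ z in 𝓝[≠] w, deriv h z ≠ 0 := by
  have hd := hh.analyticAt (hV.mem_nhds hw)
  refine hd.deriv.eventually_eq_zero_or_eventually_ne_zero.resolve_left fun hzero => ?_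
  have hderiv : ∀ᶠ z in 𝓝 w, HasDerivAt h 0 z := by
    filter_upwards [hzero, hV.mem_nhds hw] with z hz hzV
    exact hz ▸ (hh.differentiableAt (hV.mem_nhds hzV)).hasDerivAt
  refine not_eventually_eq_of_injOn hi (hV.mem_nhds hw) ?_
  simpa using eventually_sub_eq_sub_of_hasDerivAt hderiv
    (.of_forall fun z => hasDerivAt_const z (0 : ℂ))

theorem deriv_ne_zero_of_injOn {V : Set ℂ} (hV : IsOpen V) {h : ℂ → ℂ}
    (hh : DifferentiableOn ℂ h V) (hi : InjOn h V) {w : ℂ} (hw : w ∈ V) : deriv h w ≠ 0 := by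
  have hne := eventually_deriv_ne_zero_of_injOn hV hh hi hw
  obtain ⟨e, rfl, rfl⟩ := exists_openPartialHomeomorph_of_differentiableOn hV hh hi
  have hsymm : ContinuousAt e.symm (e w) := e.continuousAt_symm (e.map_source hw)
  have htendsto : Tendsto e.symm (𝓝[≠] (e w)) (𝓝[≠] w) := by
    refine tendsto_nhdsWithin_iff.2 ⟨?_, ?_⟩
    · simpa only [e.left_inv hw] using hsymm.tendsto.mono_left nhdsWithin_le_nhds
    · filter_upwards [self_mem_nhdsWithin,
        mem_nhdsWithin_of_mem_nhds (e.open_target.mem_nhds (e.map_source hw))] with y hy hyt hyw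
      exact hy (by rw [mem_singleton_iff, ← hyw, e.right_inv hyt])
  have hdiff : ∀ᶠ y in 𝓝[≠] (e w), DifferentiableAt ℂ e.symm y := by
    filter_upwards [htendsto.eventually hne,
      mem_nhdsWithin_of_mem_nhds (e.open_target.mem_nhds (e.map_source hw))] with y hy hyt
    exact (e.hasDerivAt_symm hyt hy
      (hh.differentiableAt (hV.mem_nhds (e.map_target hyt))).hasDerivAt).differentiableAt
  have hd := (Complex.analyticAt_of_differentiable_on_punctured_nhds_of_continuousAt hdiff
    hsymm).differentiableAt.hasDerivAt.comp w (hh.differentiableAt (hV.mem_nhds hw)).hasDerivAt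
  have hid : HasDerivAt (e.symm ∘ e) 1 w :=
    (hasDerivAt_id w).congr_of_eventuallyEq (e.eventually_left_inverse hw)
  exact right_ne_zero_of_mul_eq_one (hd.unique hid)

/-! ### Wirtinger derivatives -/

/-- The first order operator `(∂/∂x + c ∂/∂y) / 2`. It is `∂/∂z` for `c = -i` and `∂/∂z̄` for
`c = i`, so that the calculus of both Wirtinger derivatives is developed at once. -/
noncomputable def wirtinger (c : ℂ) (f : ℂ → ℂ) (z : ℂ) : ℂ :=
  (fderiv ℝ f z 1 + c * fderiv ℝ f z Complex.I) / 2

/-- `p` is the weak derivative `wirtinger c f` on `Ω`. -/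
def IsWeakWirtinger (c : ℂ) (Ω : Set ℂ) (f p : ℂ → ℂ) : Prop :=
  ∀ ψ : ℂ → ℂ, IsTestFunction Ω ψ → ∫ z in Ω, f z * wirtinger c ψ z = -∫ z in Ω, p z * ψ z

theorem wirtinger_neg_I : wirtinger (-Complex.I) = dz := by
  ext f z
  rw [wirtinger, dz, neg_mul, sub_eq_add_neg]

theorem wirtinger_I : wirtinger Complex.I = dzbar := rfl

theorem isWeakWirtinger_neg_I {Ω : Set ℂ} {f p : ℂ → ℂ} :
    IsWeakWirtinger (-Complex.I) Ω f p ↔ IsWeakDz Ω f p := by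
  rw [IsWeakWirtinger, wirtinger_neg_I, IsWeakDz]

theorem isWeakWirtinger_I {Ω : Set ℂ} {f p : ℂ → ℂ} :
    IsWeakWirtinger Complex.I Ω f p ↔ IsWeakDzbar Ω f p := Iff.rfl

section Wirtinger
variable {c d : ℂ} {f g : ℂ → ℂ} {z : ℂ}

theorem clm_apply_eq_re_mul_add_im_mul (L : ℂ →L[ℝ] ℂ) (v : ℂ) :
    L v = v.re * L 1 + v.im * L Complex.I := by
  have hv : v = v.re • (1 : ℂ) + v.im • Complex.I := by simp [Complex.re_add_im]
  conv_lhs => rw [hv, map_add, map_smul, map_smul, Complex.real_smul, Complex.real_smul]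

theorem fderiv_apply_eq_dz_mul_add_dzbar_mul (f : ℂ → ℂ) (z v : ℂ) :
    fderiv ℝ f z v = dz f z * v + dzbar f z * conj v := by
  rw [clm_apply_eq_re_mul_add_im_mul, dz, dzbar]
  apply Complex.ext <;> simp <;> ring

theorem wirtinger_eq_of_hasFDerivAt {L : ℂ →L[ℝ] ℂ} (h : HasFDerivAt f L z) :
    wirtinger c f z = (L 1 + c * L Complex.I) / 2 := by
  rw [wirtinger, h.fderiv]

theorem wirtinger_congr (h : f =ᶠ[𝓝 z] g) : wirtinger c f z = wirtinger c g z := by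
  rw [wirtinger, wirtinger, h.fderiv_eq]

theorem wirtinger_mul (hf : DifferentiableAt ℝ f z) (hg : DifferentiableAt ℝ g z) :
    wirtinger c (fun x => f x * g x) z = wirtinger c f z * g z + f z * wirtinger c g z := by
  rw [wirtinger_eq_of_hasFDerivAt (f := fun x => f x * g x) (hf.hasFDerivAt.mul hg.hasFDerivAt),
    wirtinger, wirtinger]
  simp
  ring

theorem wirtinger_comp (hg : DifferentiableAt ℝ g (f z)) (hf : DifferentiableAt ℝ f z) :
    wirtinger c (fun x => g (f x)) z =
      dz g (f z) * wirtinger c f z + dzbar g (f z) * conj (wirtinger (conj c) f z) := by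
  rw [wirtinger_eq_of_hasFDerivAt (f := fun x => g (f x)) (hg.hasFDerivAt.comp z hf.hasFDerivAt)]
  simp only [ContinuousLinearMap.comp_apply, fderiv_apply_eq_dz_mul_add_dzbar_mul g, wirtinger,
    map_div₀, map_add, map_mul, Complex.conj_conj, Complex.conj_ofNat]
  ring

theorem wirtinger_comp_const_sub (hg : DifferentiableAt ℝ g (d - z)) :
    wirtinger c (fun x => g (d - x)) z = -wirtinger c g (d - z) := by
  rw [wirtinger_eq_of_hasFDerivAt (f := fun x => g (d - x))
    (hg.hasFDerivAt.comp z ((hasFDerivAt_id z).const_sub d)), wirtinger]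
  simp
  ring

theorem wirtinger_eq_of_hasDerivAt {f' : ℂ} (h : HasDerivAt f f' z) :
    wirtinger c f z = f' * ((1 + c * Complex.I) / 2) := by
  rw [wirtinger_eq_of_hasFDerivAt (h.hasFDerivAt.restrictScalars ℝ)]
  simp
  ring

theorem dz_eq_of_hasDerivAt {f' : ℂ} (h : HasDerivAt f f' z) : dz f z = f' := by
  rw [← wirtinger_neg_I, wirtinger_eq_of_hasDerivAt h]
  simp

theorem dzbar_eq_zero_of_hasDerivAt {f' : ℂ} (h : HasDerivAt f f' z) : dzbar f z = 0 := by
  rw [← wirtinger_I, wirtinger_eq_of_hasDerivAt h]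
  simp

theorem differentiableAt_of_dzbar_eq_zero (hf : DifferentiableAt ℝ f z) (h : dzbar f z = 0) :
    DifferentiableAt ℂ f z := by
  refine (differentiableAt_iff_restrictScalars ℝ hf).2
    ⟨ContinuousLinearMap.toSpanSingleton ℂ (dz f z), ContinuousLinearMap.ext fun v => ?_⟩
  simp [fderiv_apply_eq_dz_mul_add_dzbar_mul, h, mul_comm]

theorem contDiff_wirtinger (hf : ContDiff ℝ ∞ f) : ContDiff ℝ ∞ (wirtinger c f) := by
  have : ContDiff ℝ ∞ (fderiv ℝ f) := hf.fderiv_right (by simp)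
  unfold wirtinger
  fun_prop

theorem tsupport_wirtinger_subset (c : ℂ) (f : ℂ → ℂ) : tsupport (wirtinger c f) ⊆ tsupport f := by
  refine closure_minimal (fun z hz => ?_) isClosed_closure
  by_contra h
  have : fderiv ℝ f z = 0 := by
    by_contra h'
    exact h (support_fderiv_subset ℝ h')
  exact hz (by simp [wirtinger, this])

theorem hasCompactSupport_wirtinger (hf : HasCompactSupport f) :
    HasCompactSupport (wirtinger c f) :=
  hf.mono' (subset_closure.trans (tsupport_wirtinger_subset c f))

theorem IsTestFunction.wirtinger {Ω : Set ℂ} (h : IsTestFunction Ω f) (c : ℂ) :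
    IsTestFunction Ω (wirtinger c f) :=
  ⟨contDiff_wirtinger h.1, hasCompactSupport_wirtinger h.2.1,
    (tsupport_wirtinger_subset c f).trans h.2.2⟩

theorem wirtinger_comm (hf : ContDiff ℝ ∞ f) (z : ℂ) :
    wirtinger c (wirtinger d f) z = wirtinger d (wirtinger c f) z := by
  have hd : HasFDerivAt (fderiv ℝ f) (fderiv ℝ (fderiv ℝ f) z) z :=
    ((hf.fderiv_right (m := ∞) (by simp)).differentiable (by simp) z).hasFDerivAt
  have hsymm : IsSymmSndFDerivAt ℝ f z := hf.contDiffAt.isSymmSndFDerivAt (by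
    rw [minSmoothness_of_isRCLikeNormedField]
    exact WithTop.coe_le_coe.2 (le_top : (2 : ℕ∞) ≤ ⊤))
  have hflip (v : ℂ) :
      HasFDerivAt (fun x => fderiv ℝ f x v) ((fderiv ℝ (fderiv ℝ f) z).flip v) z := by
    simpa using hd.clm_apply (hasFDerivAt_const v z)
  have hw (a : ℂ) : HasFDerivAt (wirtinger a f) _ z :=
    (((hflip 1).add ((hflip Complex.I).const_mul a)).mul_const (2 : ℂ)⁻¹).congr_of_eventuallyEq
      (.of_forall fun x => by simp [wirtinger, div_eq_mul_inv])
  rw [wirtinger_eq_of_hasFDerivAt (hw d), wirtinger_eq_of_hasFDerivAt (hw c)]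
  simp [hsymm.eq 1 Complex.I]
  ring

theorem integral_fderiv_apply_eq_zero {E : Type*} [NormedAddCommGroup E] [NormedSpace ℝ E]
    [MeasurableSpace E] [BorelSpace E] [FiniteDimensional ℝ E] (μ : Measure E) [μ.IsAddHaarMeasure]
    {ψ : E → ℂ} (hψ : ContDiff ℝ 1 ψ) (hc : HasCompactSupport ψ) (v : E) :
    ∫ x, fderiv ℝ ψ x v ∂μ = 0 := by
  have hint : Integrable (fun x => fderiv ℝ ψ x v) μ :=
    ((hψ.continuous_fderiv one_ne_zero).clm_apply continuous_const).integrable_of_hasCompactSupport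
      (hc.fderiv_apply ℝ v)
  simpa using integral_mul_fderiv_eq_neg_fderiv_mul_of_integrable (μ := μ)
    (f := fun _ => (1 : ℂ)) (g := ψ) (v := v) (by simp) (by simpa using hint)
    (by simpa using hψ.continuous.integrable_of_hasCompactSupport hc) (fun x _ => by fun_prop)
    (fun x _ => hψ.differentiable one_ne_zero x)

theorem integral_wirtinger_eq_zero (hf : ContDiff ℝ 1 f) (hc : HasCompactSupport f) :
    ∫ z, wirtinger c f z = 0 := by
  have hint (v : ℂ) : Integrable (fun z => fderiv ℝ f z v) :=
    ((hf.continuous_fderiv one_ne_zero).clm_apply continuous_const).integrable_of_hasCompactSupport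
      (hc.fderiv_apply ℝ v)
  simp only [wirtinger]
  rw [integral_div, integral_add (hint 1) ((hint _).const_mul _), integral_const_mul,
    integral_fderiv_apply_eq_zero _ hf hc, integral_fderiv_apply_eq_zero _ hf hc]
  simp

theorem integral_mul_wirtinger (hf : ContDiff ℝ ∞ f) (hg : ContDiff ℝ ∞ g)
    (hc : HasCompactSupport g) :
    ∫ z, f z * wirtinger c g z = -∫ z, wirtinger c f z * g z := by
  have hzero := integral_wirtinger_eq_zero (c := c) ((hf.mul hg).of_le (by simp)) hc.mul_left
  simp only [wirtinger_mul (hf.differentiable (by simp) _)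
    (hg.differentiable (by simp) _)] at hzero
  rw [integral_add (f := fun z => wirtinger c f z * g z) (g := fun z => f z * wirtinger c g z)
    (((contDiff_wirtinger hf).continuous.mul hg.continuous).integrable_of_hasCompactSupport
      hc.mul_left)
    ((hf.continuous.mul (contDiff_wirtinger hg).continuous).integrable_of_hasCompactSupport
      (hasCompactSupport_wirtinger hc).mul_left)] at hzero
  exact eq_neg_of_add_eq_zero_right hzero

theorem IsWeakWirtinger.integral_mul_wirtinger_eq {Ω : Set ℂ} {p q : ℂ → ℂ}
    (hp : IsWeakWirtinger c Ω f p) (hq : IsWeakWirtinger d Ω f q) (hg : IsTestFunction Ω g) :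
    ∫ z in Ω, p z * wirtinger d g z = ∫ z in Ω, q z * wirtinger c g z := by
  have hpd := hp _ (hg.wirtinger d)
  simp only [wirtinger_comm (c := c) (d := d) hg.1] at hpd
  exact neg_injective (hpd.symm.trans (hq _ (hg.wirtinger c)))

end Wirtinger

section Smoothing
variable {X E : Type*} [MeasurableSpace X] {ν : Measure X} [NormedAddCommGroup E]
  {F : X → E} {b : X → ℂ} {ρ : E → ℂ}

theorem integrable_comp_sub_mul (hF : AEStronglyMeasurable F ν) (hb : Integrable b ν)
    (hρ : Continuous ρ) (hc : HasCompactSupport ρ) (w : E) :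
    Integrable (fun x => ρ (w - F x) * b x) ν := by
  obtain ⟨C, hC⟩ := hc.exists_bound_of_continuous hρ
  exact hb.bdd_mul (hρ.comp_aestronglyMeasurable (aestronglyMeasurable_const.sub hF))
    (.of_forall fun x => hC _)

theorem integrable_smul_fderiv_comp_sub [NormedSpace ℝ E] (hF : AEStronglyMeasurable F ν)
    (hb : Integrable b ν) (hρ : ContDiff ℝ 1 ρ) (hc : HasCompactSupport ρ) (w : E) :
    Integrable (fun x => b x • fderiv ℝ ρ (w - F x)) ν := by
  obtain ⟨C, hC⟩ := (hc.fderiv ℝ).exists_bound_of_continuous (hρ.continuous_fderiv one_ne_zero)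
  exact hb.smul_bdd C ((hρ.continuous_fderiv one_ne_zero).comp_aestronglyMeasurable
    (aestronglyMeasurable_const.sub hF)) (.of_forall fun x => hC _)

theorem hasFDerivAt_integral_comp_sub_mul [NormedSpace ℝ E] (hF : AEStronglyMeasurable F ν)
    (hb : Integrable b ν) (hρ : ContDiff ℝ 1 ρ) (hc : HasCompactSupport ρ) (w : E) :
    HasFDerivAt (fun w => ∫ x, ρ (w - F x) * b x ∂ν) (∫ x, b x • fderiv ℝ ρ (w - F x) ∂ν) w := by
  obtain ⟨C, hC⟩ := (hc.fderiv ℝ).exists_bound_of_continuous (hρ.continuous_fderiv one_ne_zero)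
  refine hasFDerivAt_integral_of_dominated_of_fderiv_le (bound := fun x => ‖b x‖ * C)
    (F' := fun w x => b x • fderiv ℝ ρ (w - F x)) univ_mem
    (.of_forall fun w => (integrable_comp_sub_mul hF hb hρ.continuous hc w).1)
    (integrable_comp_sub_mul hF hb hρ.continuous hc w)
    (integrable_smul_fderiv_comp_sub hF hb hρ hc w).1
    (.of_forall fun x w _ => ?_) (hb.norm.mul_const C) (.of_forall fun x w _ => ?_)
  · rw [norm_smul]
    gcongr
    exact hC _
  · exact ((hρ.differentiable one_ne_zero _).hasFDerivAt.comp w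
      ((hasFDerivAt_id w).sub_const (F x))).mul_const (b x)

theorem fderiv_integral_comp_sub_mul_apply [NormedSpace ℝ E] (hF : AEStronglyMeasurable F ν)
    (hb : Integrable b ν) (hρ : ContDiff ℝ 1 ρ) (hc : HasCompactSupport ρ) (w v : E) :
    fderiv ℝ (fun w => ∫ x, ρ (w - F x) * b x ∂ν) w v = ∫ x, fderiv ℝ ρ (w - F x) v * b x ∂ν := by
  rw [(hasFDerivAt_integral_comp_sub_mul hF hb hρ hc w).fderiv,
    ContinuousLinearMap.integral_apply (integrable_smul_fderiv_comp_sub hF hb hρ hc w)]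
  simp [mul_comm]

theorem wirtinger_integral_comp_sub_mul {c : ℂ} {F : X → ℂ} {ρ : ℂ → ℂ}
    (hF : AEStronglyMeasurable F ν) (hb : Integrable b ν) (hρ : ContDiff ℝ 1 ρ)
    (hc : HasCompactSupport ρ) (w : ℂ) :
    wirtinger c (fun w => ∫ x, ρ (w - F x) * b x ∂ν) w =
      ∫ x, wirtinger c ρ (w - F x) * b x ∂ν := by
  have hint (v : ℂ) : Integrable (fun x => fderiv ℝ ρ (w - F x) v * b x) ν :=
    integrable_comp_sub_mul hF hb (ρ := fun z => fderiv ℝ ρ z v)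
      ((hρ.continuous_fderiv one_ne_zero).clm_apply continuous_const) (hc.fderiv_apply ℝ v) w
  simp only [wirtinger, fderiv_integral_comp_sub_mul_apply hF hb hρ hc]
  rw [← integral_const_mul, ← integral_add (hint 1) ((hint _).const_mul _), ← integral_div]
  congr 1 with x
  ring

end Smoothing

/-! ### Mollification -/

section LpBound
variable {E : Type*} [NormedAddCommGroup E] [NormedSpace ℝ E]

theorem enorm_integral_rpow_le {X : Type*} [MeasurableSpace X] {ν : Measure X}
    [IsProbabilityMeasure ν] {u : X → E} (hu : AEStronglyMeasurable u ν) {p : ℝ≥0} (hp : 1 ≤ p) :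
    ‖∫ x, u x ∂ν‖ₑ ^ (p : ℝ) ≤ ∫⁻ x, ‖u x‖ₑ ^ (p : ℝ) ∂ν := by
  calc ‖∫ x, u x ∂ν‖ₑ ^ (p : ℝ) ≤ eLpNorm u 1 ν ^ (p : ℝ) := by
        gcongr
        rw [eLpNorm_one_eq_lintegral_enorm]
        exact enorm_integral_le_lintegral_enorm u
    _ ≤ eLpNorm u p ν ^ (p : ℝ) := by
        gcongr
        exact eLpNorm_le_eLpNorm_of_exponent_le (by exact_mod_cast hp) hu
    _ = _ := eLpNorm_nnreal_pow_eq_lintegral (zero_lt_one.trans_le hp).ne'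

theorem eLpNorm_integral_comp_sub_le {G : Type*} [AddGroup G] [MeasurableSpace G]
    [MeasurableAdd₂ G] [MeasurableNeg G] {μ ν : Measure G} [SFinite μ] [μ.IsAddRightInvariant]
    [IsProbabilityMeasure ν] {g : G → E} (hg : StronglyMeasurable g) {p : ℝ≥0} (hp : 1 ≤ p) :
    eLpNorm (fun z => ∫ t, g (z - t) ∂ν) p μ ≤ eLpNorm g p μ := by
  have hp0 : 0 < p := zero_lt_one.trans_le hp
  rw [← ENNReal.rpow_le_rpow_iff (NNReal.coe_pos.2 hp0),
    eLpNorm_nnreal_pow_eq_lintegral hp0.ne', eLpNorm_nnreal_pow_eq_lintegral hp0.ne']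
  calc ∫⁻ z, ‖∫ t, g (z - t) ∂ν‖ₑ ^ (p : ℝ) ∂μ
      ≤ ∫⁻ z, ∫⁻ t, ‖g (z - t)‖ₑ ^ (p : ℝ) ∂ν ∂μ := lintegral_mono fun z =>
        enorm_integral_rpow_le
          (hg.comp_measurable (measurable_const.sub measurable_id)).aestronglyMeasurable hp
    _ = ∫⁻ t, ∫⁻ z, ‖g (z - t)‖ₑ ^ (p : ℝ) ∂μ ∂ν := lintegral_lintegral_swap
        ((hg.comp_measurable (measurable_fst.sub measurable_snd)).enorm.pow_const _).aemeasurable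
    _ = ∫⁻ _, ∫⁻ z, ‖g z‖ₑ ^ (p : ℝ) ∂μ ∂ν :=
        lintegral_congr fun t => lintegral_sub_right_eq_self (fun z => ‖g z‖ₑ ^ (p : ℝ)) t
    _ = ∫⁻ z, ‖g z‖ₑ ^ (p : ℝ) ∂μ := by simp

end LpBound

section Mollify
variable {G E : Type*} [NormedAddCommGroup G] [NormedSpace ℝ G] [MeasurableSpace G] [BorelSpace G]
  [FiniteDimensional ℝ G] [NormedAddCommGroup E] [NormedSpace ℝ E]
  {μ : Measure G} [μ.IsAddHaarMeasure] {φ : ContDiffBump (0 : G)} {g h : G → E}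

/-- The mollification of `g` with respect to `μ`: the convolution with a normalized bump
function. -/
noncomputable def mollify (μ : Measure G) (φ : ContDiffBump (0 : G)) (g : G → E) : G → E :=
  convolution (φ.normed μ) g (ContinuousLinearMap.lsmul ℝ ℝ) μ

theorem contDiff_mollify [CompleteSpace E] (hg : LocallyIntegrable g μ) :
    ContDiff ℝ ∞ (mollify μ φ g) :=
  φ.hasCompactSupport_normed.contDiff_convolution_left _ φ.contDiff_normed hg

theorem mollify_sub (hg : LocallyIntegrable g μ) (hh : LocallyIntegrable h μ) :
    mollify μ φ (g - h) = mollify μ φ g - mollify μ φ h := by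
  ext z
  have hconv {u : G → E} (hu : LocallyIntegrable u μ) :
      Integrable (fun t => φ.normed μ t • u (z - t)) μ :=
    φ.hasCompactSupport_normed.convolutionExists_left (ContinuousLinearMap.lsmul ℝ ℝ)
      φ.continuous_normed hu z
  simpa [mollify, convolution, smul_sub] using integral_sub (hconv hg) (hconv hh)

theorem eLpNorm_mollify_le (hg : AEStronglyMeasurable g μ) {p : ℝ≥0} (hp : 1 ≤ p) :
    eLpNorm (mollify μ φ g) p μ ≤ eLpNorm g p μ := by
  have hmk : mollify μ φ g = mollify μ φ (hg.mk g) := convolution_congr _ (ae_eq_refl _) hg.ae_eq_mk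
  have hmeas : Measurable fun t => ENNReal.ofReal (φ.normed μ t) :=
    φ.continuous_normed.measurable.ennreal_ofReal
  have : IsProbabilityMeasure (μ.withDensity fun t => ENNReal.ofReal (φ.normed μ t)) := ⟨by
    rw [withDensity_apply _ .univ, Measure.restrict_univ, ← ofReal_integral_eq_lintegral_ofReal
      φ.integrable_normed (.of_forall φ.nonneg_normed), φ.integral_normed, ENNReal.ofReal_one]⟩
  have hint (z : G) : mollify μ φ (hg.mk g) z =
      ∫ t, hg.mk g (z - t) ∂μ.withDensity fun t => ENNReal.ofReal (φ.normed μ t) := by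
    rw [integral_withDensity_eq_integral_toReal_smul hmeas
      (.of_forall fun _ => ENNReal.ofReal_lt_top)]
    simp [mollify, convolution, ENNReal.toReal_ofReal (φ.nonneg_normed _)]
  rw [hmk, funext hint, eLpNorm_congr_ae hg.ae_eq_mk]
  exact eLpNorm_integral_comp_sub_le hg.stronglyMeasurable_mk hp

theorem support_mollify_subset : Function.support (mollify μ φ g) ⊆
    Metric.cthickening φ.rOut (tsupport g) := by
  intro z hz
  obtain ⟨a, ha, b, hb, rfl⟩ := support_convolution_subset _ hz
  rw [φ.support_normed_eq, mem_ball_zero_iff] at ha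
  exact Metric.mem_cthickening_of_dist_le _ b _ _ (subset_closure hb) (by simpa using ha.le)

theorem tendsto_nhds_zero_of_eventually_le_ofReal_mul {ι : Type*} {l : Filter ι} {u : ι → ℝ≥0∞}
    {B : ℝ≥0∞} (hB : B ≠ ⊤) (h : ∀ c : ℝ, 0 < c → ∀ᶠ i in l, u i ≤ ENNReal.ofReal c * B) :
    Tendsto u l (𝓝 0) := by
  have hlim : Tendsto (fun c : ℝ => ENNReal.ofReal c * B) (𝓝[>] 0) (𝓝 0) := by
    simpa using ENNReal.Tendsto.mul_const
      ((ENNReal.continuous_ofReal.tendsto 0).mono_left nhdsWithin_le_nhds) (.inr hB) (b := B)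
  refine ENNReal.tendsto_nhds_zero.2 fun ε hε => ?_
  obtain ⟨c, hcε, hc⟩ := ((ENNReal.tendsto_nhds_zero.1 hlim ε hε).and self_mem_nhdsWithin).exists
  exact (h c hc).mono fun i hi => hi.trans hcε

section Convergence
variable {ι : Type*} {l : Filter ι} {φ : ι → ContDiffBump (0 : G)}
  (hφ : Tendsto (fun i => (φ i).rOut) l (𝓝 0))
include hφ

theorem tendsto_eLpNorm_mollify_sub_of_continuous [CompleteSpace E] (hg : Continuous g)
    (hgc : HasCompactSupport g) {p : ℝ≥0∞} (hp : p ≠ ⊤) :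
    Tendsto (fun i => eLpNorm (mollify μ (φ i) g - g) p μ) l (𝓝 0) := by
  have hK : IsCompact (Metric.cthickening 1 (tsupport g)) := hgc.isCompact.cthickening
  refine tendsto_nhds_zero_of_eventually_le_ofReal_mul
    (B := μ (Metric.cthickening 1 (tsupport g)) ^ (1 / p.toReal))
    (ENNReal.rpow_ne_top_of_nonneg (one_div_nonneg.2 ENNReal.toReal_nonneg)
      (hK.measure_lt_top (μ := μ)).ne) fun c hc => ?_
  obtain ⟨δ, hδ0, hδ⟩ := Metric.uniformContinuous_iff.1
    (hg.uniformContinuous_of_tendsto_cocompact hgc.is_zero_at_infty) c hc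
  filter_upwards [hφ.eventually_lt_const (lt_min hδ0 one_pos)] with i hi
  refine eLpNorm_sub_le_of_dist_bdd μ hp hK.measurableSet hc.le (fun x => ?_) ?_ ?_
  · exact (φ i).dist_normed_convolution_le hg.aestronglyMeasurable fun y hy =>
      (hδ ((Metric.mem_ball.1 hy).trans (hi.trans_le (min_le_left _ _)))).le
  · exact support_mollify_subset.trans
      (Metric.cthickening_mono (hi.le.trans (min_le_right _ _)) _)
  · exact subset_closure.trans (Metric.self_subset_cthickening _)

theorem tendsto_eLpNorm_mollify_sub [CompleteSpace E] {p : ℝ≥0} (hp : 1 ≤ p)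
    (hg : MemLp g p μ) :
    Tendsto (fun i => eLpNorm (mollify μ (φ i) g - g) p μ) l (𝓝 0) := by
  have hp1 : (1 : ℝ≥0∞) ≤ p := by exact_mod_cast hp
  have hmeas {i : ι} {v : G → E} (hv : MemLp v p μ) : AEStronglyMeasurable (mollify μ (φ i) v) μ :=
    (contDiff_mollify (hv.locallyIntegrable hp1)).continuous.aestronglyMeasurable
  refine ENNReal.tendsto_nhds_zero.2 fun ε hε => ?_
  have hε3 : ε / 3 ≠ 0 := by simp [hε.ne']
  obtain ⟨u, huc, hgu, hucont, hu⟩ :=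
    hg.exists_hasCompactSupport_eLpNorm_sub_le ENNReal.coe_ne_top hε3
  filter_upwards [ENNReal.tendsto_nhds_zero.1 (tendsto_eLpNorm_mollify_sub_of_continuous (μ := μ)
    hφ hucont huc ENNReal.coe_ne_top) (ε / 3) (pos_iff_ne_zero.2 hε3)] with i hi
  have hdecomp : mollify μ (φ i) g - g =
      mollify μ (φ i) (g - u) + (mollify μ (φ i) u - u) + (u - g) := by
    rw [mollify_sub (hg.locallyIntegrable hp1) (hu.locallyIntegrable hp1)]
    abel
  calc eLpNorm (mollify μ (φ i) g - g) p μ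
      ≤ eLpNorm (mollify μ (φ i) (g - u)) p μ + eLpNorm (mollify μ (φ i) u - u) p μ
        + eLpNorm (u - g) p μ := by
        rw [hdecomp]
        refine (eLpNorm_add_le ((hmeas (hg.sub hu)).add ((hmeas hu).sub hu.1)) (hu.1.sub hg.1)
          hp1).trans ?_
        gcongr
        exact eLpNorm_add_le (hmeas (hg.sub hu)) ((hmeas hu).sub hu.1) hp1
    _ ≤ ε / 3 + ε / 3 + ε / 3 := by
        rw [eLpNorm_sub_comm u]
        gcongr
        exact (eLpNorm_mollify_le (hg.1.sub hu.1) hp).trans hgu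
    _ = ε := ENNReal.add_thirds ε

end Convergence

end Mollify

/-! ### Convergence in `L²` -/

section TendstoL2
variable {X : Type*} [MeasurableSpace X] {ν : Measure X} {a a' : ℕ → X → ℂ} {b b' w : X → ℂ}

/-- Convergence in `L²(ν)` of a sequence of square integrable functions. -/
structure TendstoL2 (ν : Measure X) (a : ℕ → X → ℂ) (b : X → ℂ) : Prop where
  memLp_seq : ∀ n, MemLp (a n) 2 ν
  memLp : MemLp b 2 ν
  tendsto : Tendsto (fun n => eLpNorm (a n - b) 2 ν) atTop (𝓝 0)

theorem tendstoL2_const (hb : MemLp b 2 ν) : TendstoL2 ν (fun _ => b) b :=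
  ⟨fun _ => hb, hb, by simp⟩

theorem TendstoL2.congr_ae (h : TendstoL2 ν a b) (hb : b =ᵐ[ν] b') : TendstoL2 ν a b' :=
  ⟨h.memLp_seq, (memLp_congr_ae hb).1 h.memLp, h.tendsto.congr fun n =>
    eLpNorm_congr_ae ((ae_eq_refl (a n)).sub hb)⟩

theorem TendstoL2.add (h : TendstoL2 ν a b) (h' : TendstoL2 ν a' b') :
    TendstoL2 ν (fun n x => a n x + a' n x) (fun x => b x + b' x) where
  memLp_seq n := (h.memLp_seq n).add (h'.memLp_seq n)
  memLp := h.memLp.add h'.memLp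
  tendsto := by
    have hsum := h.tendsto.add h'.tendsto
    rw [add_zero] at hsum
    refine tendsto_of_tendsto_of_tendsto_of_le_of_le tendsto_const_nhds hsum (fun _ => zero_le)
      fun n => le_of_eq_of_le ?_ (eLpNorm_add_le ((h.memLp_seq n).1.sub h.memLp.1)
        ((h'.memLp_seq n).1.sub h'.memLp.1) one_le_two)
    congr 1
    ext x
    simp only [Pi.sub_apply, Pi.add_apply]
    ring

theorem memLp_conj {p : ℝ≥0∞} (hb : MemLp b p ν) : MemLp (fun x => conj (b x)) p ν :=
  hb.congr_norm (Complex.continuous_conj.comp_aestronglyMeasurable hb.1)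
    (.of_forall fun x => (RCLike.norm_conj (b x)).symm)

theorem TendstoL2.conj (h : TendstoL2 ν a b) :
    TendstoL2 ν (fun n x => conj (a n x)) (fun x => conj (b x)) where
  memLp_seq n := memLp_conj (h.memLp_seq n)
  memLp := memLp_conj h.memLp
  tendsto := h.tendsto.congr fun n => eLpNorm_congr_norm_ae <| .of_forall fun x => by
    simp only [Pi.sub_apply, ← map_sub, RCLike.norm_conj]

theorem TendstoL2.tendsto_integral_mul (h : TendstoL2 ν a b) (hw : MemLp w 2 ν) :
    Tendsto (fun n => ∫ x, a n x * w x ∂ν) atTop (𝓝 (∫ x, b x * w x ∂ν)) := by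
  refine tendsto_integral_of_L1' _ (h.memLp.integrable_mul hw).1
    (.of_forall fun n => (h.memLp_seq n).integrable_mul hw) ?_
  have hprod := ENNReal.Tendsto.mul_const h.tendsto (.inr hw.2.ne)
  rw [zero_mul] at hprod
  refine tendsto_of_tendsto_of_tendsto_of_le_of_le tendsto_const_nhds hprod (fun _ => zero_le)
    fun n => le_of_eq_of_le ?_ (eLpNorm_smul_le_mul_eLpNorm hw.1
      ((h.memLp_seq n).1.sub h.memLp.1) (r := 1))
  congr 1
  ext x
  simp [sub_mul]

theorem eLpNorm_mul_le_of_forall_norm_le {K : Set X} (hK : MeasurableSet K) {v : X → ℂ}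
    {p : ℝ≥0∞} {C : ℝ} (hC : ∀ x ∈ K, ‖v x‖ ≤ C) :
    eLpNorm (fun x => v x * b x) p (ν.restrict K) ≤
      ENNReal.ofReal C * eLpNorm b p (ν.restrict K) := by
  refine eLpNorm_le_mul_eLpNorm_of_ae_le_mul
    ((ae_restrict_iff' hK).2 (.of_forall fun x hx => ?_)) _
  rw [norm_mul]
  gcongr
  exact hC x hx

variable [TopologicalSpace X] [T2Space X] [OpensMeasurableSpace X] {K : Set X} {u : ℕ → X → ℂ}
  {v : X → ℂ}

theorem memLp_mul_of_continuousOn (hK : IsCompact K) (hv : ContinuousOn v K) {p : ℝ≥0∞}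
    (hb : MemLp b p (ν.restrict K)) : MemLp (fun x => v x * b x) p (ν.restrict K) := by
  obtain ⟨C, hC⟩ := hK.exists_bound_of_continuousOn hv
  refine hb.of_le_mul (c := C) ((hv.aestronglyMeasurable hK.measurableSet).mul hb.1)
    ((ae_restrict_iff' hK.measurableSet).2 (.of_forall fun x hx => ?_))
  rw [norm_mul]
  gcongr
  exact hC x hx

theorem memLp_of_continuousOn_isCompact [IsFiniteMeasureOnCompacts ν] (hK : IsCompact K)
    (hv : ContinuousOn v K) {p : ℝ≥0∞} : MemLp v p (ν.restrict K) := by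
  have : IsFiniteMeasure (ν.restrict K) := isFiniteMeasure_restrict.2 hK.measure_lt_top.ne
  simpa using memLp_mul_of_continuousOn (ν := ν) hK hv (memLp_const (1 : ℂ))

theorem TendstoL2.mul_tendstoUniformlyOn (h : TendstoL2 (ν.restrict K) a b) (hK : IsCompact K)
    (hu : ∀ n, ContinuousOn (u n) K) (huv : TendstoUniformlyOn u v atTop K) :
    TendstoL2 (ν.restrict K) (fun n x => u n x * a n x) (fun x => v x * b x) := by
  have hv : ContinuousOn v K := huv.continuousOn (.of_forall hu)
  refine ⟨fun n => memLp_mul_of_continuousOn hK (hu n) (h.memLp_seq n),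
    memLp_mul_of_continuousOn hK hv h.memLp, ?_⟩
  obtain ⟨C, hC⟩ := hK.exists_bound_of_continuousOn hv
  have hdist {c : ℝ} (hc : 0 < c) : ∀ᶠ n in atTop, ∀ x ∈ K, ‖u n x - v x‖ ≤ c :=
    (Metric.tendstoUniformlyOn_iff.1 huv c hc).mono fun n hn x hx => by
      rw [norm_sub_rev, ← dist_eq_norm]
      exact (hn x hx).le
  have hbounded : Tendsto (fun n => eLpNorm (fun x => u n x * (a n - b) x) 2 (ν.restrict K))
      atTop (𝓝 0) := by
    have hlim := ENNReal.Tendsto.const_mul h.tendsto (.inr (ENNReal.ofReal_ne_top (r := C + 1)))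
    rw [mul_zero] at hlim
    refine tendsto_of_tendsto_of_tendsto_of_le_of_le' tendsto_const_nhds hlim
      (.of_forall fun _ => zero_le) ?_
    filter_upwards [hdist one_pos] with n hn
    exact eLpNorm_mul_le_of_forall_norm_le hK.measurableSet fun x hx =>
      (norm_le_norm_add_norm_sub' _ _).trans (add_le_add (hC x hx) (hn x hx))
  have hsmall : Tendsto (fun n => eLpNorm (fun x => (u n x - v x) * b x) 2 (ν.restrict K))
      atTop (𝓝 0) :=
    tendsto_nhds_zero_of_eventually_le_ofReal_mul h.memLp.2.ne fun c hc =>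
      (hdist hc).mono fun n hn => eLpNorm_mul_le_of_forall_norm_le hK.measurableSet hn
  have hsum := hbounded.add hsmall
  rw [add_zero] at hsum
  have hmeas {g : X → ℂ} (hg : ContinuousOn g K) : AEStronglyMeasurable g (ν.restrict K) :=
    hg.aestronglyMeasurable hK.measurableSet
  refine tendsto_of_tendsto_of_tendsto_of_le_of_le tendsto_const_nhds hsum (fun _ => zero_le)
    fun n => le_of_eq_of_le ?_ (eLpNorm_add_le
      ((hmeas (hu n)).mul ((h.memLp_seq n).1.sub h.memLp.1))
      (((hmeas (hu n)).sub (hmeas hv)).mul h.memLp.1) one_le_two)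
  congr 1
  ext x
  simp only [Pi.sub_apply, Pi.add_apply]
  ring

end TendstoL2

section TestFunction
variable {Ω K : Set ℂ}

theorem exists_isTestFunction_eventuallyEq_one (hΩ : IsOpen Ω) (hK : IsCompact K) (hKΩ : K ⊆ Ω) :
    ∃ χ : ℂ → ℂ, IsTestFunction Ω χ ∧ ∀ z ∈ K, χ =ᶠ[𝓝 z] fun _ => 1 := by
  obtain ⟨L, hL, hKL, hLΩ⟩ := exists_compact_between hK hΩ hKΩ
  obtain ⟨χ, hone, hzero, -⟩ := exists_contMDiffMap_one_nhds_of_subset_interior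
    (n := (⊤ : ℕ∞)) (modelWithCornersSelf ℝ ℂ) hK.isClosed hKL
  have hsupp : tsupport (fun z => (χ z : ℂ)) ⊆ L := by
    refine closure_minimal (fun z hz => ?_) hL.isClosed
    by_contra h
    exact hz (by simp [hzero z h])
  refine ⟨fun z => (χ z : ℂ), ⟨Complex.ofRealCLM.contDiff.comp χ.contMDiff.contDiff,
    hL.of_isClosed_subset (isClosed_tsupport _) hsupp, hsupp.trans hLΩ⟩, fun z hz => ?_⟩
  filter_upwards [(eventually_nhdsSet_iff_forall.1 hone) z hz] with x hx
  simp [hx]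

theorem setIntegral_mul_eq_of_tsupport_subset {ψ : ℂ → ℂ} (hΩ : MeasurableSet Ω) (hKΩ : K ⊆ Ω)
    (hψ : tsupport ψ ⊆ K) (u : ℂ → ℂ) : ∫ z in Ω, u z * ψ z = ∫ z in K, u z * ψ z :=
  setIntegral_eq_of_subset_of_forall_sdiff_eq_zero hΩ hKΩ fun z hz => by
    simp [image_eq_zero_of_notMem_tsupport fun h => hz.2 (hψ h)]

theorem integral_mul_indicator_eq_setIntegral {f ψ : ℂ → ℂ} (hΩ : MeasurableSet Ω) (hKΩ : K ⊆ Ω)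
    (hψ : tsupport ψ ⊆ K) : ∫ w, ψ w * K.indicator f w = ∫ w in Ω, f w * ψ w := by
  rw [← integral_indicator hΩ]
  congr 1 with w
  by_cases hw : w ∈ K
  · simp [hw, hKΩ hw, mul_comm]
  · simp [hw, image_eq_zero_of_notMem_tsupport fun h => hw (hψ h), indicator]

theorem IsTestFunction.mono {ψ : ℂ → ℂ} (h : IsTestFunction K ψ) (hKΩ : K ⊆ Ω) :
    IsTestFunction Ω ψ :=
  ⟨h.1, h.2.1, h.2.2.trans hKΩ⟩

theorem IsWeakWirtinger.mono {c : ℂ} {f p : ℂ → ℂ} (h : IsWeakWirtinger c Ω f p)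
    (hΩ : MeasurableSet Ω) (hKΩ : K ⊆ Ω) : IsWeakWirtinger c K f p := fun ψ hψ => by
  rw [← setIntegral_mul_eq_of_tsupport_subset hΩ hKΩ hψ.2.2,
    ← setIntegral_mul_eq_of_tsupport_subset hΩ hKΩ ((tsupport_wirtinger_subset c ψ).trans hψ.2.2)]
  exact h ψ (hψ.mono hKΩ)

end TestFunction

/-! ### Smooth approximation of weak derivatives -/

section Mollify
variable {φ : ContDiffBump (0 : ℂ)} {c z : ℂ} {Ω K : Set ℂ} {f p : ℂ → ℂ}

/-- The normalized bump function `φ.normed volume`, as a complex valued function. -/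
noncomputable def bumpKernel (φ : ContDiffBump (0 : ℂ)) (z : ℂ) : ℂ := (φ.normed volume z : ℂ)

theorem contDiff_bumpKernel : ContDiff ℝ ∞ (bumpKernel φ) :=
  Complex.ofRealCLM.contDiff.comp φ.contDiff_normed

theorem tsupport_bumpKernel : tsupport (bumpKernel φ) = Metric.closedBall 0 φ.rOut := by
  rw [← φ.tsupport_normed_eq (μ := volume), tsupport, tsupport]
  congr 1
  ext z
  simp [bumpKernel]

theorem hasCompactSupport_bumpKernel : HasCompactSupport (bumpKernel φ) := by
  rw [HasCompactSupport, tsupport_bumpKernel]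
  exact isCompact_closedBall _ _

theorem mollify_eq_integral_bumpKernel (g : ℂ → ℂ) (z : ℂ) :
    mollify volume φ g z = ∫ w, bumpKernel φ (z - w) * g w := by
  rw [mollify, convolution_lsmul_swap]
  simp [bumpKernel]

theorem isTestFunction_bumpKernel_sub (h : Metric.closedBall z φ.rOut ⊆ Ω) :
    IsTestFunction Ω fun w => bumpKernel φ (z - w) := by
  have hsupp : tsupport (fun w => bumpKernel φ (z - w)) ⊆ Metric.closedBall z φ.rOut := by
    refine closure_minimal (fun w hw => ?_) Metric.isClosed_closedBall
    have hmem : z - w ∈ tsupport (bumpKernel φ) := subset_closure hw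
    rw [tsupport_bumpKernel] at hmem
    simpa [dist_eq_norm, norm_sub_rev] using hmem
  exact ⟨contDiff_bumpKernel.comp (contDiff_const.sub contDiff_id),
    (isCompact_closedBall z _).of_isClosed_subset (isClosed_tsupport _) hsupp, hsupp.trans h⟩

theorem wirtinger_mollify_indicator (hΩ : MeasurableSet Ω) (hKΩ : K ⊆ Ω)
    (hp : IsWeakWirtinger c Ω f p) (hf : Integrable (K.indicator f))
    (hz : Metric.closedBall z φ.rOut ⊆ K) :
    wirtinger c (mollify volume φ (K.indicator f)) z =
      mollify volume φ (K.indicator p) z := by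
  have hψ : IsTestFunction K fun w => bumpKernel φ (z - w) := isTestFunction_bumpKernel_sub hz
  have hweak := hp _ (hψ.mono hKΩ)
  rw [← integral_mul_indicator_eq_setIntegral hΩ hKΩ (hψ.wirtinger c).2.2,
    ← integral_mul_indicator_eq_setIntegral hΩ hKΩ hψ.2.2] at hweak
  simp only [wirtinger_comp_const_sub (contDiff_bumpKernel.differentiable (by simp) _), neg_mul,
    integral_neg, neg_inj] at hweak
  rw [mollify_eq_integral_bumpKernel, ← hweak, funext (mollify_eq_integral_bumpKernel _)]
  exact wirtinger_integral_comp_sub_mul aestronglyMeasurable_id hf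
    (contDiff_bumpKernel.of_le (by simp)) hasCompactSupport_bumpKernel z

end Mollify

section UniformMollify
variable {G E ι : Type*} [NormedAddCommGroup G] [NormedSpace ℝ G] [MeasurableSpace G]
  [BorelSpace G] [FiniteDimensional ℝ G] [NormedAddCommGroup E] [NormedSpace ℝ E] [CompleteSpace E]
  {μ : Measure G} [μ.IsAddHaarMeasure] {l : Filter ι} {φ : ι → ContDiffBump (0 : G)} {f : G → E}
  {K L : Set G} {δ : ℝ}

theorem tendstoUniformlyOn_mollify_indicator (hφ : Tendsto (fun i => (φ i).rOut) l (𝓝 0))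
    (hK : IsCompact K) (hf : ContinuousOn f K) (hδ : 0 < δ) (hLK : Metric.cthickening δ L ⊆ K) :
    TendstoUniformlyOn (fun i => mollify μ (φ i) (K.indicator f)) f l L := by
  have hLK' : L ⊆ K := (Metric.self_subset_cthickening L).trans hLK
  refine Metric.tendstoUniformlyOn_iff.2 fun ε hε => ?_
  obtain ⟨η, hη, hfη⟩ := Metric.uniformContinuousOn_iff.1
    (hK.uniformContinuousOn_of_continuous hf) (ε / 2) (half_pos hε)
  filter_upwards [hφ.eventually_lt_const (lt_min hδ hη)] with i hi z hz
  have hclose : dist (mollify μ (φ i) (K.indicator f) z) (K.indicator f z) ≤ ε / 2 := by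
    refine (φ i).dist_normed_convolution_le ((aestronglyMeasurable_indicator_iff
      hK.measurableSet).2 (hf.aestronglyMeasurable hK.measurableSet)) fun x hx => ?_
    have hxz : dist x z < min δ η := (Metric.mem_ball.1 hx).trans hi
    have hxK : x ∈ K := hLK (Metric.mem_cthickening_of_dist_le x z δ L hz
      (hxz.le.trans (min_le_left _ _)))
    rw [indicator_of_mem hxK, indicator_of_mem (hLK' hz)]
    exact (hfη x hxK z (hLK' hz) (hxz.trans_le (min_le_right _ _))).le
  rw [indicator_of_mem (hLK' hz), dist_comm] at hclose
  linarith

end UniformMollify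

/-- A sequence of bump functions whose supports shrink to the origin. -/
noncomputable def shrinkingBump (n : ℕ) : ContDiffBump (0 : ℂ) where
  rIn := 1 / (n + 2)
  rOut := 1 / (n + 1)
  rIn_pos := by positivity
  rIn_lt_rOut := by gcongr; norm_num

theorem tendsto_shrinkingBump_rOut : Tendsto (fun n => (shrinkingBump n).rOut) atTop (𝓝 0) :=
  tendsto_one_div_add_atTop_nhds_zero_nat

theorem tendsto_eLpNorm_wirtinger_mollify_indicator_sub {c : ℂ} {Ω K L : Set ℂ} {f p : ℂ → ℂ}
    {δ : ℝ} (hΩ : MeasurableSet Ω) (hK : MeasurableSet K) (hL : MeasurableSet L) (hδ : 0 < δ)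
    (hKL : Metric.cthickening δ K ⊆ L) (hLΩ : L ⊆ Ω) (hp : MemLp p 2 (volume.restrict L))
    (hpf : IsWeakWirtinger c Ω f p) (hf : Integrable (L.indicator f)) :
    Tendsto (fun n => eLpNorm (wirtinger c (mollify volume (shrinkingBump n) (L.indicator f)) - p) 2
      (volume.restrict K)) atTop (𝓝 0) := by
  have hlim : Tendsto (fun n => eLpNorm (mollify volume (shrinkingBump n) (L.indicator p) -
      L.indicator p) 2 volume) atTop (𝓝 0) := by
    exact_mod_cast tendsto_eLpNorm_mollify_sub (p := 2) tendsto_shrinkingBump_rOut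
      one_le_two (by exact_mod_cast (memLp_indicator_iff_restrict hL).2 hp)
  refine tendsto_of_tendsto_of_tendsto_of_le_of_le' tendsto_const_nhds hlim
    (.of_forall fun _ => zero_le) ?_
  filter_upwards [tendsto_shrinkingBump_rOut.eventually_lt_const hδ] with n hn
  refine le_of_eq_of_le (eLpNorm_congr_ae ((ae_restrict_iff' hK).2 (.of_forall fun z hz => ?_)))
    (eLpNorm_mono_measure _ Measure.restrict_le_self)
  have hball : Metric.closedBall z (shrinkingBump n).rOut ⊆ L :=
    (Metric.closedBall_subset_cthickening hz _).trans ((Metric.cthickening_mono hn.le _).trans hKL)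
  have hzL : z ∈ L := hKL (Metric.self_subset_cthickening K hz)
  simp [wirtinger_mollify_indicator hΩ hLΩ hpf hf hball, hzL]

/-- `f` has the derivative `wirtinger c f = p` on the compact set `K` in the sense of Friedrichs:
the smooth functions `F n` converge uniformly to `f` and their derivatives converge to `p` in
`L²`. -/
structure SmoothApprox (c : ℂ) (K : Set ℂ) (F : ℕ → ℂ → ℂ) (f p : ℂ → ℂ) : Prop where
  contDiff : ∀ n, ContDiff ℝ ∞ (F n)
  tendstoUniformlyOn : TendstoUniformlyOn F f atTop K
  tendstoL2 : TendstoL2 (volume.restrict K) (fun n => wirtinger c (F n)) p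

namespace SmoothApprox
variable {c d : ℂ} {K Ω : Set ℂ} {F A : ℕ → ℂ → ℂ} {f a g p q r : ℂ → ℂ}

theorem continuousOn (hf : SmoothApprox c K F f p) : ContinuousOn f K :=
  hf.tendstoUniformlyOn.continuousOn (.of_forall fun n => (hf.contDiff n).continuous.continuousOn)

theorem congr (hf : SmoothApprox c K F f p) (hK : MeasurableSet K) (hfg : EqOn f g K)
    (hpq : EqOn p q K) : SmoothApprox c K F g q :=
  ⟨hf.contDiff, hf.tendstoUniformlyOn.congr_right hfg,
    hf.tendstoL2.congr_ae (hpq.aeEq_restrict hK)⟩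

theorem of_contDiff (hK : IsCompact K) (hg : ContDiff ℝ ∞ g) :
    SmoothApprox c K (fun _ => g) g (wirtinger c g) where
  contDiff _ := hg
  tendstoUniformlyOn _ hU := .of_forall fun _ _ _ => refl_mem_uniformity hU
  tendstoL2 := tendstoL2_const
    (memLp_of_continuousOn_isCompact hK (contDiff_wirtinger hg).continuous.continuousOn)

theorem mul (hf : SmoothApprox c K F f p) (ha : SmoothApprox c K A a q) (hK : IsCompact K) :
    SmoothApprox c K (fun n z => F n z * A n z) (fun z => f z * a z)
      (fun z => a z * p z + f z * q z) where
  contDiff n := (hf.contDiff n).mul (ha.contDiff n)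
  tendstoUniformlyOn := by
    have hlocal := hf.tendstoUniformlyOn.tendstoLocallyUniformlyOn.mul₀
      ha.tendstoUniformlyOn.tendstoLocallyUniformlyOn hf.continuousOn ha.continuousOn
    exact (tendstoLocallyUniformlyOn_iff_tendstoUniformlyOn_of_compact hK).1 hlocal
  tendstoL2 := by
    have hcont {B : ℕ → ℂ → ℂ} {b r : ℂ → ℂ} (h : SmoothApprox c K B b r) (n : ℕ) :
        ContinuousOn (B n) K := (h.contDiff n).continuous.continuousOn
    have hderiv (n : ℕ) : wirtinger c (fun z => F n z * A n z) = fun z =>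
        A n z * wirtinger c (F n) z + F n z * wirtinger c (A n) z := by
      ext z
      rw [wirtinger_mul ((hf.contDiff n).differentiable (by simp) z)
        ((ha.contDiff n).differentiable (by simp) z), mul_comm (wirtinger c (F n) z)]
    rw [funext hderiv]
    exact (hf.tendstoL2.mul_tendstoUniformlyOn hK (hcont ha) ha.tendstoUniformlyOn).add
      (ha.tendstoL2.mul_tendstoUniformlyOn hK (hcont hf) hf.tendstoUniformlyOn)

theorem comp (hp : SmoothApprox c K F f p) (hq : SmoothApprox (conj c) K F f q)
    (hK : IsCompact K) (hg : ContDiff ℝ ∞ g) (hgc : HasCompactSupport g) :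
    SmoothApprox c K (fun n z => g (F n z)) (fun z => g (f z))
      (fun z => dz g (f z) * p z + dzbar g (f z) * conj (q z)) where
  contDiff n := hg.comp (hp.contDiff n)
  tendstoUniformlyOn := (hg.continuous.uniformContinuous_of_tendsto_cocompact
    hgc.is_zero_at_infty).comp_tendstoUniformlyOn hp.tendstoUniformlyOn
  tendstoL2 := by
    have hderiv (n : ℕ) : wirtinger c (fun z => g (F n z)) = fun z =>
        dz g (F n z) * wirtinger c (F n) z +
          dzbar g (F n z) * conj (wirtinger (conj c) (F n) z) := by
      ext z
      exact wirtinger_comp (hg.differentiable (by simp) _)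
        ((hp.contDiff n).differentiable (by simp) _)
    have hcont (d : ℂ) : Continuous (wirtinger d g) := (contDiff_wirtinger hg).continuous
    have hunif (d : ℂ) : TendstoUniformlyOn (fun n z => wirtinger d g (F n z))
        (fun z => wirtinger d g (f z)) atTop K :=
      ((hcont d).uniformContinuous_of_tendsto_cocompact
        (hasCompactSupport_wirtinger hgc).is_zero_at_infty).comp_tendstoUniformlyOn
          hp.tendstoUniformlyOn
    have hcontF (d : ℂ) (n : ℕ) : ContinuousOn (fun z => wirtinger d g (F n z)) K :=
      ((hcont d).comp (hp.contDiff n).continuous).continuousOn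
    rw [funext hderiv, ← wirtinger_neg_I, ← wirtinger_I]
    exact (hp.tendstoL2.mul_tendstoUniformlyOn hK (hcontF _) (hunif _)).add
      (hq.tendstoL2.conj.mul_tendstoUniformlyOn hK (hcontF _) (hunif _))

theorem exists_of_continuousOn (hΩ : IsOpen Ω) (hf : ContinuousOn f Ω) (hK : IsCompact K)
    (hKΩ : K ⊆ Ω) : ∃ F : ℕ → ℂ → ℂ, ∀ c p, MemL2Loc Ω p → IsWeakWirtinger c Ω f p →
      SmoothApprox c K F f p := by
  obtain ⟨δ, hδ, hδΩ⟩ := hK.exists_cthickening_subset_open hΩ hKΩ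
  set L := Metric.cthickening δ K
  have hL : IsCompact L := hK.cthickening
  have hint : Integrable (L.indicator f) :=
    (integrable_indicator_iff hL.measurableSet).2 ((hf.mono hδΩ).integrableOn_compact hL)
  have hsmooth (n : ℕ) : ContDiff ℝ ∞ (mollify volume (shrinkingBump n) (L.indicator f)) :=
    contDiff_mollify hint.locallyIntegrable
  refine ⟨fun n => mollify volume (shrinkingBump n) (L.indicator f), fun c p hp hpf => ?_⟩
  have hwirt (n : ℕ) :
      ContDiff ℝ ∞ (wirtinger c (mollify volume (shrinkingBump n) (L.indicator f))) :=
    contDiff_wirtinger (hsmooth n)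
  exact ⟨hsmooth,
    tendstoUniformlyOn_mollify_indicator tendsto_shrinkingBump_rOut hL (hf.mono hδΩ) hδ subset_rfl,
    fun n => memLp_of_continuousOn_isCompact hK (hwirt n).continuous.continuousOn, hp K hK hKΩ,
    tendsto_eLpNorm_wirtinger_mollify_indicator_sub hΩ.measurableSet hK.measurableSet
      hL.measurableSet hδ subset_rfl hδΩ (hp L hL hδΩ) hpf hint⟩

theorem integral_mul_wirtinger (hf : SmoothApprox c K F f p) (hK : IsCompact K) {ψ : ℂ → ℂ}
    (hψ : IsTestFunction K ψ) :
    ∫ z in K, f z * wirtinger c ψ z = -∫ z in K, p z * ψ z := by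
  have hψL2 (b : ℂ → ℂ) (hb : Continuous b) : MemLp b 2 (volume.restrict K) :=
    memLp_of_continuousOn_isCompact hK hb.continuousOn
  have hfψ := ((tendstoL2_const (hψL2 (fun _ => 1) continuous_const)).mul_tendstoUniformlyOn hK
    (fun n => (hf.contDiff n).continuous.continuousOn) hf.tendstoUniformlyOn).tendsto_integral_mul
    (hψL2 _ (hψ.wirtinger c).1.continuous)
  simp only [mul_one] at hfψ
  refine tendsto_nhds_unique hfψ
    ((hf.tendstoL2.tendsto_integral_mul (hψL2 ψ hψ.1.continuous)).neg.congr fun n => ?_)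
  rw [← setIntegral_mul_eq_of_tsupport_subset .univ (subset_univ K) hψ.2.2,
    ← setIntegral_mul_eq_of_tsupport_subset .univ (subset_univ K) (hψ.wirtinger c).2.2,
    setIntegral_univ, setIntegral_univ]
  exact (_root_.integral_mul_wirtinger (hf.contDiff n) hψ.1 hψ.2.1).symm

theorem isWeakWirtinger (hΩ : MeasurableSet Ω)
    (h : ∀ K ⊆ Ω, IsCompact K → ∃ F, SmoothApprox c K F f p) : IsWeakWirtinger c Ω f p :=
  fun ψ hψ => by
  obtain ⟨F, hF⟩ := h _ hψ.2.2 hψ.2.1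
  rw [setIntegral_mul_eq_of_tsupport_subset hΩ hψ.2.2 subset_rfl,
    setIntegral_mul_eq_of_tsupport_subset hΩ hψ.2.2 (tsupport_wirtinger_subset c ψ)]
  exact hF.integral_mul_wirtinger hψ.2.1 ⟨hψ.1, hψ.2.1, subset_rfl⟩

theorem integral_mul_sub_mul_eq_zero (hp : SmoothApprox c K F f p) (hq : SmoothApprox d K F f q)
    (hF : ∀ n, tsupport (F n) ⊆ K) (hΩ : MeasurableSet Ω) (hK : IsCompact K) (hKΩ : K ⊆ Ω)
    {a u v : ℂ → ℂ} (hu : IsWeakWirtinger c Ω a u) (hv : IsWeakWirtinger d Ω a v)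
    (hu2 : MemLp u 2 (volume.restrict K)) (hv2 : MemLp v 2 (volume.restrict K)) :
    ∫ z in K, (p z * v z - q z * u z) = 0 := by
  have hswap (n : ℕ) :
      ∫ z in K, wirtinger d (F n) z * u z = ∫ z in K, wirtinger c (F n) z * v z := by
    have hFn : IsTestFunction K (F n) :=
      ⟨hp.contDiff n, hK.of_isClosed_subset (isClosed_tsupport _) (hF n), hF n⟩
    have hΩswap := hu.integral_mul_wirtinger_eq hv (hFn.mono hKΩ)
    rw [setIntegral_mul_eq_of_tsupport_subset hΩ hKΩ (hFn.wirtinger d).2.2,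
      setIntegral_mul_eq_of_tsupport_subset hΩ hKΩ (hFn.wirtinger c).2.2] at hΩswap
    simpa only [mul_comm] using hΩswap
  have hlim := tendsto_nhds_unique (hp.tendstoL2.tendsto_integral_mul hv2)
    ((hq.tendstoL2.tendsto_integral_mul hu2).congr hswap)
  exact (integral_sub (hp.tendstoL2.memLp.integrable_mul hv2)
    (hq.tendstoL2.memLp.integrable_mul hu2)).trans (sub_eq_zero.2 hlim)

end SmoothApprox

/-! ### Solutions of the Beltrami equation -/

/-- `f` is a continuous solution of the Beltrami equation on `Ω` with weak derivatives `p = ∂f/∂z`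
and `q = ∂f/∂z̄`. -/
structure IsContinuousBeltramiSolution (Ω : Set ℂ) (μ f p q : ℂ → ℂ) : Prop where
  continuousOn : ContinuousOn f Ω
  memL2Loc_dz : MemL2Loc Ω p
  memL2Loc_dzbar : MemL2Loc Ω q
  isWeakDz : IsWeakDz Ω f p
  isWeakDzbar : IsWeakDzbar Ω f q
  eq_mul : ∀ᵐ z ∂volume.restrict Ω, q z = μ z * p z

/-- The Jacobian of a function with Wirtinger derivatives `p` and `q`. -/
noncomputable def wirtingerJacobian (p q : ℂ → ℂ) (z : ℂ) : ℝ := ‖p z‖ ^ 2 - ‖q z‖ ^ 2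

theorem ofReal_wirtingerJacobian (p q : ℂ → ℂ) (z : ℂ) :
    (wirtingerJacobian p q z : ℂ) = p z * conj (p z) - q z * conj (q z) := by
  simp [wirtingerJacobian, Complex.mul_conj, Complex.normSq_eq_norm_sq]

theorem integrableOn_wirtingerJacobian {Ω K : Set ℂ} {p q : ℂ → ℂ} (hp : MemL2Loc Ω p)
    (hq : MemL2Loc Ω q) (hK : IsCompact K) (hKΩ : K ⊆ Ω) :
    IntegrableOn (wirtingerJacobian p q) K :=
  (hp K hK hKΩ).norm.integrable_sq.sub (hq K hK hKΩ).norm.integrable_sq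

namespace IsContinuousBeltramiSolution
variable {Ω D K : Set ℂ} {μ f p q a pa qa η : ℂ → ℂ}

theorem mono (h : IsContinuousBeltramiSolution Ω μ f p q) (hΩ : MeasurableSet Ω) (hD : D ⊆ Ω) :
    IsContinuousBeltramiSolution D μ f p q where
  continuousOn := h.continuousOn.mono hD
  memL2Loc_dz K hK hKD := h.memL2Loc_dz K hK (hKD.trans hD)
  memL2Loc_dzbar K hK hKD := h.memL2Loc_dzbar K hK (hKD.trans hD)
  isWeakDz := isWeakWirtinger_neg_I.1 ((isWeakWirtinger_neg_I.2 h.isWeakDz).mono hΩ hD)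
  isWeakDzbar := isWeakWirtinger_I.1 ((isWeakWirtinger_I.2 h.isWeakDzbar).mono hΩ hD)
  eq_mul := ae_restrict_of_ae_restrict_of_subset hD h.eq_mul

theorem one (hΩ : MeasurableSet Ω) (μ : ℂ → ℂ) :
    IsContinuousBeltramiSolution Ω μ (fun _ => 1) (fun _ => 0) (fun _ => 0) := by
  have hweak (c : ℂ) : IsWeakWirtinger c Ω (fun _ => 1) (fun _ => 0) := by
    refine SmoothApprox.isWeakWirtinger hΩ fun K _ hK => ⟨fun _ _ => 1, ?_⟩
    have hzero : wirtinger c (fun _ => 1) = fun _ => 0 := by ext z; simp [wirtinger]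
    exact hzero ▸ SmoothApprox.of_contDiff hK contDiff_const
  exact ⟨continuousOn_const, fun _ _ _ => .zero, fun _ _ _ => .zero,
    isWeakWirtinger_neg_I.1 (hweak _), isWeakWirtinger_I.1 (hweak _), by simp⟩

theorem exists_smoothApprox (h : IsContinuousBeltramiSolution Ω μ f p q) (hΩ : IsOpen Ω)
    (hK : IsCompact K) (hKΩ : K ⊆ Ω) : ∃ F : ℕ → ℂ → ℂ,
      SmoothApprox (-Complex.I) K F f p ∧ SmoothApprox Complex.I K F f q :=
  (SmoothApprox.exists_of_continuousOn hΩ h.continuousOn hK hKΩ).imp fun _ hF =>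
    ⟨hF _ p h.memL2Loc_dz (isWeakWirtinger_neg_I.2 h.isWeakDz),
      hF _ q h.memL2Loc_dzbar (isWeakWirtinger_I.2 h.isWeakDzbar)⟩

theorem wirtingerJacobian_nonneg (h : IsContinuousBeltramiSolution Ω μ f p q)
    (hμ : ∀ᵐ z ∂volume.restrict Ω, ‖μ z‖ < 1) :
    ∀ᵐ z ∂volume.restrict Ω, 0 ≤ wirtingerJacobian p q z ∧
      (wirtingerJacobian p q z = 0 → p z = 0 ∧ q z = 0) := by
  filter_upwards [h.eq_mul, hμ] with z hz hμz
  have hJ : wirtingerJacobian p q z = (1 - ‖μ z‖ ^ 2) * ‖p z‖ ^ 2 := by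
    rw [wirtingerJacobian, hz, norm_mul]
    ring
  have hpos : 0 < 1 - ‖μ z‖ ^ 2 := by nlinarith [norm_nonneg (μ z)]
  refine ⟨by rw [hJ]; positivity, fun hJ0 => ?_⟩
  rw [hJ, mul_eq_zero, or_iff_right hpos.ne'] at hJ0
  have hp0 : p z = 0 := by simpa using hJ0
  exact ⟨hp0, by rw [hz, hp0, mul_zero]⟩

/- The weak derivatives of `f` commute when tested against a localization of `a · η ∘ f`; the terms
containing derivatives of `a` cancel because `a` and `f` satisfy the same Beltrami equation. -/
theorem integral_dzbar_comp_mul_jacobian_eq_zero (hf : IsContinuousBeltramiSolution Ω μ f p q)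
    (ha : IsContinuousBeltramiSolution Ω μ a pa qa) (hΩ : IsOpen Ω) (hη : ContDiff ℝ ∞ η)
    (hηc : HasCompactSupport η) (hK : IsCompact K) (hKΩ : K ⊆ Ω)
    (hKη : ∀ z ∈ Ω, f z ∈ tsupport η → z ∈ K) :
    ∫ z in Ω, dzbar η (f z) * (a z * wirtingerJacobian p q z) = 0 := by
  obtain ⟨χ, hχ, hχ1⟩ := exists_isTestFunction_eventuallyEq_one hΩ hK hKΩ
  set L := tsupport χ
  have hL : IsCompact L := hχ.2.1
  have hLΩ : L ⊆ Ω := hχ.2.2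
  have hKL : K ⊆ L := fun z hz => subset_closure (by simp [(hχ1 z hz).eq_of_nhds])
  obtain ⟨F, hFp, hFq⟩ := hf.exists_smoothApprox hΩ hL hLΩ
  obtain ⟨A, hAp, hAq⟩ := ha.exists_smoothApprox hΩ hL hLΩ
  have hGp := (SmoothApprox.of_contDiff (c := -Complex.I) hL hχ.1).mul
    (hAp.mul (hFp.comp (by simpa using hFq) hL hη hηc) hL) hL
  have hGq := (SmoothApprox.of_contDiff (c := Complex.I) hL hχ.1).mul
    (hAq.mul (hFq.comp (by simpa using hFp) hL hη hηc) hL) hL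
  have hzero := hGp.integral_mul_sub_mul_eq_zero hGq (fun n => tsupport_mul_subset_left)
    hΩ.measurableSet hL hLΩ (isWeakWirtinger_neg_I.2 hf.isWeakDz)
    (isWeakWirtinger_I.2 hf.isWeakDzbar) (hf.memL2Loc_dz L hL hLΩ) (hf.memL2Loc_dzbar L hL hLΩ)
  have hdzbar_zero {z : ℂ} (hz : f z ∉ tsupport η) : dzbar η (f z) = 0 :=
    image_eq_zero_of_notMem_tsupport fun h => hz (tsupport_wirtinger_subset Complex.I η h)
  rw [setIntegral_eq_of_subset_of_forall_sdiff_eq_zero hΩ.measurableSet hLΩ fun z hz => by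
    rw [hdzbar_zero fun h => hz.2 (hKL (hKη z hz.1 h)), zero_mul],
    ← neg_eq_zero, ← integral_neg, ← hzero]
  refine integral_congr_ae ?_
  filter_upwards [ae_restrict_of_ae_restrict_of_subset hLΩ (hf.eq_mul.and ha.eq_mul),
    ae_restrict_mem hL.measurableSet] with z ⟨hz, hza⟩ hzL
  rw [ofReal_wirtingerJacobian]
  by_cases hzK : z ∈ K
  · have hwirt (c : ℂ) : wirtinger c χ z = 0 := by
      rw [wirtinger_congr (hχ1 z hzK)]
      simp [wirtinger]
    rw [hwirt, hwirt, (hχ1 z hzK).eq_of_nhds, hz, hza]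
    ring
  · have hfz : f z ∉ tsupport η := fun h => hzK (hKη z (hLΩ hzL) h)
    rw [hdzbar_zero hfz, image_eq_zero_of_notMem_tsupport hfz]
    ring

end IsContinuousBeltramiSolution

theorem eq_of_mem_ball_of_weak_dz_dzbar_eq_zero {Ω : Set ℂ} {f p q : ℂ → ℂ} {z₀ : ℂ} {r : ℝ}
    (hΩ : MeasurableSet Ω) (hf : ContinuousOn f Ω) (hp : IsWeakDz Ω f p) (hq : IsWeakDzbar Ω f q)
    (hr : Metric.closedBall z₀ r ⊆ Ω)
    (hpq : ∀ᵐ z ∂volume.restrict (Metric.closedBall z₀ r), p z = 0 ∧ q z = 0) :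
    ∀ z ∈ Metric.ball z₀ r, f z = f z₀ := by
  intro z hz
  set K := Metric.closedBall z₀ r
  obtain ⟨s, hzs, hsr⟩ := exists_between (Metric.mem_ball.1 hz)
  have hs : 0 < s := dist_nonneg.trans_lt hzs
  have hK : IsCompact K := isCompact_closedBall _ _
  have hint : Integrable (K.indicator f) :=
    (integrable_indicator_iff hK.measurableSet).2 ((hf.mono hr).integrableOn_compact hK)
  have hlim := tendstoUniformlyOn_mollify_indicator (μ := volume) (L := Metric.closedBall z₀ s)
    tendsto_shrinkingBump_rOut hK (hf.mono hr) (sub_pos.2 hsr)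
    (by rw [cthickening_closedBall (by linarith) hs.le]; simp [K])
  have hzero (u : ℂ → ℂ) (hu : ∀ᵐ z ∂volume.restrict K, u z = 0) (φ : ContDiffBump (0 : ℂ))
      (x : ℂ) : mollify volume φ (K.indicator u) x = 0 := by
    rw [mollify_eq_integral_bumpKernel]
    refine integral_eq_zero_of_ae ?_
    filter_upwards [indicator_ae_eq_zero_of_restrict_ae_eq_zero hK.measurableSet hu] with y hy
    simp [hy]
  refine tendsto_nhds_unique (hlim.tendsto_at hzs.le)
    ((hlim.tendsto_at (Metric.mem_closedBall_self hs.le)).congr' ?_)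
  filter_upwards [tendsto_shrinkingBump_rOut.eventually_lt_const (sub_pos.2 hsr)] with n hn
  refine Metric.isOpen_ball.is_const_of_fderiv_eq_zero (𝕜 := ℝ)
    (convex_ball z₀ s).isPreconnected
    ((contDiff_mollify hint.locallyIntegrable).differentiable (n := ∞) (by simp)).differentiableOn
    (fun x hx => ?_) (Metric.mem_ball_self hs) hzs
  have hball : Metric.closedBall x (shrinkingBump n).rOut ⊆ K :=
    Metric.closedBall_subset_closedBall' (by linarith [Metric.mem_ball.1 hx])
  have hp' := wirtinger_mollify_indicator hΩ hr (isWeakWirtinger_neg_I.2 hp) hint hball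
  have hq' := wirtinger_mollify_indicator hΩ hr (isWeakWirtinger_I.2 hq) hint hball
  rw [hzero p (hpq.mono fun _ h => h.1), wirtinger_neg_I] at hp'
  rw [hzero q (hpq.mono fun _ h => h.2), wirtinger_I] at hq'
  ext v
  simp [fderiv_apply_eq_dz_mul_add_dzbar_mul, hp', hq']

/-! ### Openness of injective solutions -/

/-- The closed disc of radius `r` around `z₀` lies in `Ω`, and `f` maps its boundary circle outside
the disc of radius `2 R` around `f z₀`. -/
structure IsSeparatingDisc (Ω : Set ℂ) (f : ℂ → ℂ) (z₀ : ℂ) (r R : ℝ) : Prop where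
  closedBall_subset : Metric.closedBall z₀ r ⊆ Ω
  two_mul_le_dist : ∀ z ∈ Metric.sphere z₀ r, 2 * R ≤ dist (f z) (f z₀)

theorem exists_isSeparatingDisc {Ω : Set ℂ} {f : ℂ → ℂ} {z₀ : ℂ} {r : ℝ} (hf : ContinuousOn f Ω)
    (hfi : InjOn f Ω) (hr0 : 0 < r) (hr : Metric.closedBall z₀ r ⊆ Ω) :
    ∃ R > 0, IsSeparatingDisc Ω f z₀ r R := by
  have hsphere : Metric.sphere z₀ r ⊆ Ω := Metric.sphere_subset_closedBall.trans hr
  have hcompact : IsCompact (f '' Metric.sphere z₀ r) :=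
    (isCompact_sphere z₀ r).image_of_continuousOn (hf.mono hsphere)
  have hnotMem : f z₀ ∉ f '' Metric.sphere z₀ r := by
    rintro ⟨z, hz, hzz⟩
    rw [hfi (hsphere hz) (hr (Metric.mem_closedBall_self hr0.le)) hzz, Metric.mem_sphere,
      dist_self] at hz
    exact hr0.ne hz
  obtain ⟨d, hd0, hd⟩ := Metric.mem_nhds_iff.1 (hcompact.isClosed.isOpen_compl.mem_nhds hnotMem)
  refine ⟨d / 2, half_pos hd0, hr, fun z hz => ?_⟩
  by_contra! hlt
  exact hd (Metric.mem_ball.2 (by linarith)) ⟨z, hz, rfl⟩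

theorem IsSeparatingDisc.mono {Ω : Set ℂ} {f : ℂ → ℂ} {z₀ : ℂ} {r R R' : ℝ}
    (h : IsSeparatingDisc Ω f z₀ r R) (hR : R' ≤ R) : IsSeparatingDisc Ω f z₀ r R' :=
  ⟨h.1, fun z hz => (by linarith : 2 * R' ≤ 2 * R).trans (h.2 z hz)⟩

theorem norm_integral_smul_sub_integral_smul_le {X E : Type*} [MeasurableSpace X] {ν : Measure X}
    [NormedAddCommGroup E] [NormedSpace ℝ E] [CompleteSpace E] {k : X → ℝ} {a : X → E} {b : E}
    {ε : ℝ} (hk : Integrable k ν) (hka : Integrable (fun x => k x • a x) ν) (hk0 : 0 ≤ᵐ[ν] k)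
    (hab : ∀ᵐ x ∂ν, k x ≠ 0 → ‖a x - b‖ ≤ ε) :
    ‖(∫ x, k x • a x ∂ν) - (∫ x, k x ∂ν) • b‖ ≤ (∫ x, k x ∂ν) * ε := by
  rw [← integral_smul_const, ← integral_mul_const, ← integral_sub hka (hk.smul_const b)]
  refine norm_integral_le_of_norm_le (hk.mul_const ε) ?_
  filter_upwards [hk0, hab] with x hx hxab
  rw [← smul_sub, norm_smul, Real.norm_of_nonneg hx]
  by_cases hkx : k x = 0
  · simp [hkx]
  · exact mul_le_mul_of_nonneg_left (hxab hkx) hx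

/-- The density in `z` of the change of variables `ζ = f z` applied to `φ (w - ζ) dζ`, if `p` and
`q` are the Wirtinger derivatives of `f`. -/
noncomputable def jacobianWeight (f p q : ℂ → ℂ) (φ : ContDiffBump (0 : ℂ)) (w z : ℂ) : ℝ :=
  φ.normed volume (w - f z) * wirtingerJacobian p q z

/-- The mollification of `a ∘ f⁻¹` on `f '' D`, written as an integral over `D`. -/
noncomputable def weightedMollify (D : Set ℂ) (f p q : ℂ → ℂ) (φ : ContDiffBump (0 : ℂ))
    (a : ℂ → ℂ) (w : ℂ) : ℂ :=
  ∫ z in D, jacobianWeight f p q φ w z • a z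

theorem weightedMollify_one (D : Set ℂ) (f p q : ℂ → ℂ) (φ : ContDiffBump (0 : ℂ)) (w : ℂ) :
    weightedMollify D f p q φ (fun _ => 1) w = (∫ z in D, jacobianWeight f p q φ w z : ℝ) := by
  simp only [weightedMollify, Complex.real_smul, mul_one, integral_complex_ofReal]

theorem jacobianWeight_smul (f p q : ℂ → ℂ) (φ : ContDiffBump (0 : ℂ)) (a : ℂ → ℂ) (w z : ℂ) :
    jacobianWeight f p q φ w z • a z =
      bumpKernel φ (w - f z) * (a z * wirtingerJacobian p q z) := by
  rw [jacobianWeight, bumpKernel, Complex.real_smul]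
  push_cast
  ring

theorem weightedMollify_eq_integral_bumpKernel (D : Set ℂ) (f p q : ℂ → ℂ)
    (φ : ContDiffBump (0 : ℂ)) (a : ℂ → ℂ) : weightedMollify D f p q φ a =
      fun w => ∫ z in D, bumpKernel φ (w - f z) * (a z * wirtingerJacobian p q z) := by
  funext w
  simp only [weightedMollify, jacobianWeight_smul]

theorem dist_lt_of_jacobianWeight_ne_zero {f p q : ℂ → ℂ} {φ : ContDiffBump (0 : ℂ)} {w z : ℂ}
    (h : jacobianWeight f p q φ w z ≠ 0) : dist (f z) w < φ.rOut := by
  have hmem : w - f z ∈ Function.support (φ.normed volume) := left_ne_zero_of_mul h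
  rwa [φ.support_normed_eq, Metric.mem_ball, dist_zero_right, ← dist_eq_norm, dist_comm] at hmem

section SeparatingDisc
variable {Ω : Set ℂ} {μ f p q a pa qa : ℂ → ℂ} {z₀ w : ℂ} {r R : ℝ} {φ : ContDiffBump (0 : ℂ)}

namespace IsContinuousBeltramiSolution

theorem integrableOn_mul_jacobian (hf : IsContinuousBeltramiSolution Ω μ f p q)
    (hr : Metric.closedBall z₀ r ⊆ Ω) (ha : ContinuousOn a Ω) :
    IntegrableOn (fun z => a z * (wirtingerJacobian p q z : ℂ)) (Metric.ball z₀ r) := by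
  have hK := isCompact_closedBall z₀ r
  have hJ := (integrableOn_wirtingerJacobian hf.memL2Loc_dz hf.memL2Loc_dzbar hK hr).ofReal (𝕜 := ℂ)
  have hprod := memLp_mul_of_continuousOn hK (ha.mono hr) (memLp_one_iff_integrable.2 hJ)
  exact IntegrableOn.mono_set (memLp_one_iff_integrable.1 hprod) Metric.ball_subset_closedBall

theorem aestronglyMeasurable (hf : IsContinuousBeltramiSolution Ω μ f p q)
    (hr : Metric.closedBall z₀ r ⊆ Ω) :
    AEStronglyMeasurable f (volume.restrict (Metric.ball z₀ r)) :=
  (hf.continuousOn.mono (Metric.ball_subset_closedBall.trans hr)).aestronglyMeasurable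
    Metric.isOpen_ball.measurableSet

theorem integrableOn_jacobianWeight_smul (hf : IsContinuousBeltramiSolution Ω μ f p q)
    (hr : Metric.closedBall z₀ r ⊆ Ω) (ha : ContinuousOn a Ω) :
    IntegrableOn (fun z => jacobianWeight f p q φ w z • a z) (Metric.ball z₀ r) := by
  simp only [jacobianWeight_smul]
  exact integrable_comp_sub_mul (hf.aestronglyMeasurable hr) (hf.integrableOn_mul_jacobian hr ha)
    contDiff_bumpKernel.continuous hasCompactSupport_bumpKernel w

theorem integrableOn_jacobianWeight (hf : IsContinuousBeltramiSolution Ω μ f p q)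
    (hr : Metric.closedBall z₀ r ⊆ Ω) :
    IntegrableOn (jacobianWeight f p q φ w) (Metric.ball z₀ r) := by
  have hint := hf.integrableOn_jacobianWeight_smul (φ := φ) (w := w) hr
    (continuousOn_const (c := (1 : ℂ)))
  rw [IntegrableOn]
  simpa using hint.re

theorem jacobianWeight_nonneg (hf : IsContinuousBeltramiSolution Ω μ f p q)
    (hμ : ∀ᵐ z ∂volume.restrict Ω, ‖μ z‖ < 1) :
    0 ≤ᵐ[volume.restrict Ω] jacobianWeight f p q φ w := by
  filter_upwards [hf.wirtingerJacobian_nonneg hμ] with z hz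
  exact mul_nonneg (φ.nonneg_normed _) hz.1

theorem differentiable_weightedMollify (hf : IsContinuousBeltramiSolution Ω μ f p q)
    (hr : Metric.closedBall z₀ r ⊆ Ω) (ha : ContinuousOn a Ω) :
    Differentiable ℝ (weightedMollify (Metric.ball z₀ r) f p q φ a) := fun w => by
  rw [weightedMollify_eq_integral_bumpKernel]
  exact (hasFDerivAt_integral_comp_sub_mul (hf.aestronglyMeasurable hr)
    (hf.integrableOn_mul_jacobian hr ha) (contDiff_bumpKernel.of_le (by simp))
    hasCompactSupport_bumpKernel w).differentiableAt

theorem dzbar_weightedMollify (hf : IsContinuousBeltramiSolution Ω μ f p q)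
    (ha : IsContinuousBeltramiSolution Ω μ a pa qa) (hΩ : IsOpen Ω)
    (hdisc : IsSeparatingDisc Ω f z₀ r R) (hφ : φ.rOut < R) (hw : w ∈ Metric.ball (f z₀) R) :
    dzbar (weightedMollify (Metric.ball z₀ r) f p q φ a) w = 0 := by
  have hr := hdisc.closedBall_subset
  have hD : Metric.ball z₀ r ⊆ Ω := Metric.ball_subset_closedBall.trans hr
  have hη := isTestFunction_bumpKernel_sub (φ := φ) (z := w) (Ω := Metric.closedBall w φ.rOut)
    subset_rfl
  set K := Metric.closedBall z₀ r ∩ f ⁻¹' Metric.closedBall w φ.rOut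
  have hK : IsCompact K := (isCompact_closedBall z₀ r).of_isClosed_subset
    ((hf.continuousOn.mono hr).preimage_isClosed_of_isClosed Metric.isClosed_closedBall
      Metric.isClosed_closedBall) inter_subset_left
  have hKD : K ⊆ Metric.ball z₀ r := by
    rintro z ⟨hz, hzw⟩
    refine (Metric.mem_closedBall.1 hz).lt_or_eq.resolve_right fun hsphere => ?_
    linarith [hdisc.two_mul_le_dist z hsphere, dist_triangle (f z) w (f z₀),
      Metric.mem_ball.1 hw, Metric.mem_closedBall.1 hzw]
  have hzero := (hf.mono hΩ.measurableSet hD).integral_dzbar_comp_mul_jacobian_eq_zero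
    (ha.mono hΩ.measurableSet hD) Metric.isOpen_ball hη.1 hη.2.1 hK hKD
    fun z hz hzη => ⟨Metric.ball_subset_closedBall hz, hη.2.2 hzη⟩
  have hderiv (z : ℂ) : dzbar (fun ζ => bumpKernel φ (w - ζ)) z =
      -wirtinger Complex.I (bumpKernel φ) (w - z) :=
    wirtinger_comp_const_sub (contDiff_bumpKernel.differentiable (by simp) _)
  simp only [hderiv, neg_mul, integral_neg, neg_eq_zero] at hzero
  rwa [← wirtinger_I, weightedMollify_eq_integral_bumpKernel,
    wirtinger_integral_comp_sub_mul (hf.aestronglyMeasurable hr)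
    (hf.integrableOn_mul_jacobian hr ha.continuousOn) (contDiff_bumpKernel.of_le (by simp))
    hasCompactSupport_bumpKernel]

theorem differentiableOn_weightedMollify (hf : IsContinuousBeltramiSolution Ω μ f p q)
    (ha : IsContinuousBeltramiSolution Ω μ a pa qa) (hΩ : IsOpen Ω)
    (hdisc : IsSeparatingDisc Ω f z₀ r R) (hφ : φ.rOut < R) :
    DifferentiableOn ℂ (weightedMollify (Metric.ball z₀ r) f p q φ a) (Metric.ball (f z₀) R) :=
  fun w hw => (differentiableAt_of_dzbar_eq_zero
    (hf.differentiable_weightedMollify hdisc.closedBall_subset ha.continuousOn w)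
    (hf.dzbar_weightedMollify ha hΩ hdisc hφ hw)).differentiableWithinAt

/- The total mass is a holomorphic function of `w`, because the constant `1` solves every Beltrami
equation, and it is real. -/
theorem integral_jacobianWeight_eq (hf : IsContinuousBeltramiSolution Ω μ f p q) (hΩ : IsOpen Ω)
    (hdisc : IsSeparatingDisc Ω f z₀ r R) (hφ : φ.rOut < R) (hw : w ∈ Metric.ball (f z₀) R) :
    ∫ z in Metric.ball z₀ r, jacobianWeight f p q φ w z =
      ∫ z in Metric.ball z₀ r, jacobianWeight f p q φ (f z₀) z := by
  have hol := hf.differentiableOn_weightedMollify (.one hΩ.measurableSet μ) hΩ hdisc hφ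
  obtain ⟨c, hc⟩ := (hol.analyticOnNhd Metric.isOpen_ball).eq_const_of_im_eq_const (c₀ := 0)
    (fun w _ => by rw [weightedMollify_one, Complex.ofReal_im]) Metric.isOpen_ball
    ((convex_ball _ _).isConnected ⟨w, hw⟩)
  have hmass := (hc w hw).trans
    (hc (f z₀) (Metric.mem_ball_self (dist_nonneg.trans_lt (Metric.mem_ball.1 hw)))).symm
  rwa [weightedMollify_one, weightedMollify_one, Complex.ofReal_inj] at hmass

theorem integral_jacobianWeight_pos (hf : IsContinuousBeltramiSolution Ω μ f p q) (hΩ : IsOpen Ω)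
    (hμ : ∀ᵐ z ∂volume.restrict Ω, ‖μ z‖ < 1) (hfi : InjOn f Ω) (hr0 : 0 < r)
    (hr : Metric.closedBall z₀ r ⊆ Ω) :
    0 < ∫ z in Metric.ball z₀ r, jacobianWeight f p q φ (f z₀) z := by
  have hD : Metric.ball z₀ r ⊆ Ω := Metric.ball_subset_closedBall.trans hr
  have hz₀ : Ω ∈ 𝓝 z₀ := hΩ.mem_nhds (hD (Metric.mem_ball_self hr0))
  have hnonneg := ae_restrict_of_ae_restrict_of_subset hD
    (hf.jacobianWeight_nonneg (φ := φ) (w := f z₀) hμ)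
  refine (integral_nonneg_of_ae hnonneg).lt_of_ne fun hmass => ?_
  have hweight := (integral_eq_zero_iff_of_nonneg_ae hnonneg (hf.integrableOn_jacobianWeight hr)).1
    hmass.symm
  obtain ⟨s, hs0, hs⟩ : ∃ s > 0, Metric.closedBall z₀ s ⊆
      Metric.ball z₀ r ∩ f ⁻¹' Metric.ball (f z₀) φ.rOut :=
    Metric.nhds_basis_closedBall.mem_iff.1 (inter_mem (Metric.ball_mem_nhds _ hr0)
      ((hf.continuousOn.continuousAt hz₀).preimage_mem_nhds (Metric.ball_mem_nhds _ φ.rOut_pos)))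
  have hsD : Metric.closedBall z₀ s ⊆ Metric.ball z₀ r := hs.trans inter_subset_left
  have hpq : ∀ᵐ z ∂volume.restrict (Metric.closedBall z₀ s), p z = 0 ∧ q z = 0 := by
    filter_upwards [ae_restrict_of_ae_restrict_of_subset (hsD.trans hD)
      (hf.wirtingerJacobian_nonneg hμ), ae_restrict_of_ae_restrict_of_subset hsD hweight,
      ae_restrict_mem Metric.isClosed_closedBall.measurableSet] with z hz hweight hzs
    refine hz.2 ((mul_eq_zero.1 hweight).resolve_left ?_)
    change f z₀ - f z ∈ Function.support (φ.normed volume)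
    rw [φ.support_normed_eq, Metric.mem_ball, dist_zero_right,
      ← dist_eq_norm, dist_comm]
    exact (hs hzs).2
  refine not_eventually_eq_of_injOn hfi hz₀ ?_
  filter_upwards [Metric.ball_mem_nhds z₀ hs0] with z hz
  exact eq_of_mem_ball_of_weak_dz_dzbar_eq_zero hΩ.measurableSet hf.continuousOn hf.isWeakDz
    hf.isWeakDzbar (hsD.trans hD) hpq z hz

theorem ball_subset_image_closedBall (hf : IsContinuousBeltramiSolution Ω μ f p q) (hΩ : IsOpen Ω)
    (hμ : ∀ᵐ z ∂volume.restrict Ω, ‖μ z‖ < 1) (hfi : InjOn f Ω) (hr0 : 0 < r)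
    (hdisc : IsSeparatingDisc Ω f z₀ r R) :
    Metric.ball (f z₀) R ⊆ f '' Metric.closedBall z₀ r := by
  intro w hw
  by_contra hwf
  have hR : 0 < R := dist_nonneg.trans_lt (Metric.mem_ball.1 hw)
  have hclosed : IsClosed (f '' Metric.closedBall z₀ r) :=
    ((isCompact_closedBall z₀ r).image_of_continuousOn
      (hf.continuousOn.mono hdisc.closedBall_subset)).isClosed
  obtain ⟨d, hd, hdball⟩ := Metric.mem_nhds_iff.1 (hclosed.isOpen_compl.mem_nhds hwf)
  obtain ⟨n, hn⟩ := (tendsto_shrinkingBump_rOut.eventually_lt_const (lt_min hR hd)).exists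
  have hpos := hf.integral_jacobianWeight_pos (φ := shrinkingBump n) hΩ hμ hfi hr0
    hdisc.closedBall_subset
  rw [← hf.integral_jacobianWeight_eq hΩ hdisc (hn.trans_le (min_le_left _ _)) hw] at hpos
  refine hpos.ne' (setIntegral_eq_zero_of_forall_eq_zero fun z hz => ?_)
  by_contra hweight
  exact hdball (Metric.mem_ball.2
    ((dist_lt_of_jacobianWeight_ne_zero hweight).trans (hn.trans_le (min_le_right _ _))))
    ⟨z, Metric.ball_subset_closedBall hz, rfl⟩

theorem exists_openPartialHomeomorph (hf : IsContinuousBeltramiSolution Ω μ f p q) (hΩ : IsOpen Ω)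
    (hμ : ∀ᵐ z ∂volume.restrict Ω, ‖μ z‖ < 1) (hfi : InjOn f Ω) :
    ∃ e : OpenPartialHomeomorph ℂ ℂ, ⇑e = f ∧ e.source = Ω := by
  refine exists_openPartialHomeomorph_of_injOn hf.continuousOn hfi hΩ fun z hz U hU => ?_
  obtain ⟨r, hr0, hr⟩ := Metric.nhds_basis_closedBall.mem_iff.1 (inter_mem (hΩ.mem_nhds hz) hU)
  obtain ⟨R, hR, hdisc⟩ :=
    exists_isSeparatingDisc hf.continuousOn hfi hr0 (hr.trans inter_subset_left)
  exact mem_of_superset (Metric.ball_mem_nhds _ hR)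
    ((hf.ball_subset_image_closedBall hΩ hμ hfi hr0 hdisc).trans
      (image_subset_iff.2 (hr.trans inter_subset_right)))

end IsContinuousBeltramiSolution

end SeparatingDisc

/-! ### Stoilow factorization -/

namespace IsContinuousBeltramiSolution
variable {Ω : Set ℂ} {μ f p q a pa qa h : ℂ → ℂ} {z₀ : ℂ} {r R : ℝ}

theorem tendstoUniformlyOn_weightedMollify (hf : IsContinuousBeltramiSolution Ω μ f p q)
    (hΩ : IsOpen Ω) (hμ : ∀ᵐ z ∂volume.restrict Ω, ‖μ z‖ < 1) (hfi : InjOn f Ω) (hr0 : 0 < r)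
    (hR0 : 0 < R) (hdisc : IsSeparatingDisc Ω f z₀ r R) (ha : ContinuousOn a Ω)
    (hh : ContinuousOn h (Metric.closedBall (f z₀) (2 * R)))
    (hha : ∀ z ∈ Metric.ball z₀ r, h (f z) = a z) :
    TendstoUniformlyOn (fun n w =>
      (∫ z in Metric.ball z₀ r, jacobianWeight f p q (shrinkingBump n) (f z₀) z)⁻¹ •
        weightedMollify (Metric.ball z₀ r) f p q (shrinkingBump n) a w)
      h atTop (Metric.ball (f z₀) R) := by
  rw [Metric.tendstoUniformlyOn_iff]
  intro ε hε
  obtain ⟨δ, hδ0, hδ⟩ := Metric.uniformContinuousOn_iff.1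
    ((isCompact_closedBall (f z₀) (2 * R)).uniformContinuousOn_of_continuous hh)
    (ε / 2) (half_pos hε)
  filter_upwards [tendsto_shrinkingBump_rOut.eventually_lt_const (lt_min hR0 hδ0)] with n hn w hw
  obtain ⟨hnR, hnδ⟩ := lt_min_iff.1 hn
  have hr := hdisc.closedBall_subset
  have hmass := hf.integral_jacobianWeight_eq hΩ hdisc hnR hw
  have hpos := hf.integral_jacobianWeight_pos (φ := shrinkingBump n) hΩ hμ hfi hr0 hr
  rw [← hmass] at hpos ⊢
  set m := ∫ z in Metric.ball z₀ r, jacobianWeight f p q (shrinkingBump n) w z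
  have hclose : ∀ᵐ z ∂volume.restrict (Metric.ball z₀ r),
      jacobianWeight f p q (shrinkingBump n) w z ≠ 0 → ‖a z - h w‖ ≤ ε / 2 := by
    filter_upwards [ae_restrict_mem Metric.isOpen_ball.measurableSet] with z hz hweight
    have hdist := dist_lt_of_jacobianWeight_ne_zero hweight
    rw [← hha z hz, ← dist_eq_norm]
    refine (hδ _ (Metric.mem_closedBall.2 ?_) _ (Metric.mem_closedBall.2 ?_)
      (hdist.trans hnδ)).le
    · linarith [dist_triangle (f z) w (f z₀), Metric.mem_ball.1 hw]
    · linarith [Metric.mem_ball.1 hw]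
  have hbound : ‖weightedMollify (Metric.ball z₀ r) f p q (shrinkingBump n) a w - m • h w‖ ≤
      m * (ε / 2) :=
    norm_integral_smul_sub_integral_smul_le (hf.integrableOn_jacobianWeight hr)
      (hf.integrableOn_jacobianWeight_smul hr ha) (ae_restrict_of_ae_restrict_of_subset
        (Metric.ball_subset_closedBall.trans hr) (hf.jacobianWeight_nonneg hμ)) hclose
  rw [dist_comm, dist_eq_norm]
  calc ‖m⁻¹ • weightedMollify (Metric.ball z₀ r) f p q (shrinkingBump n) a w - h w‖
      = m⁻¹ * ‖weightedMollify (Metric.ball z₀ r) f p q (shrinkingBump n) a w - m • h w‖ := by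
        rw [← Real.norm_of_nonneg (inv_nonneg.2 hpos.le), ← norm_smul, smul_sub,
          inv_smul_smul₀ hpos.ne', norm_inv, Real.norm_of_nonneg hpos.le]
    _ ≤ ε / 2 := (inv_mul_le_iff₀ hpos).2 hbound
    _ < ε := half_lt_self hε

theorem differentiableOn_comp_symm {e : OpenPartialHomeomorph ℂ ℂ}
    (he : IsContinuousBeltramiSolution e.source μ e p q)
    (hμ : ∀ᵐ z ∂volume.restrict e.source, ‖μ z‖ < 1)
    (ha : IsContinuousBeltramiSolution e.source μ a pa qa) :
    DifferentiableOn ℂ (a ∘ e.symm) e.target := by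
  rw [← e.image_source_eq_target]
  rintro _ ⟨z₀, hz₀, rfl⟩
  refine DifferentiableAt.differentiableWithinAt ?_
  have hΩ := e.open_source
  obtain ⟨r, hr0, hr⟩ := Metric.nhds_basis_closedBall.mem_iff.1 (hΩ.mem_nhds hz₀)
  obtain ⟨R₁, hR₁, hdisc₁⟩ := exists_isSeparatingDisc he.continuousOn e.injOn hr0 hr
  obtain ⟨R₂, hR₂, htarget⟩ := Metric.nhds_basis_closedBall.mem_iff.1
    (e.open_target.mem_nhds (e.map_source hz₀))
  have hR0 : 0 < min R₁ (R₂ / 2) := lt_min hR₁ (half_pos hR₂)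
  have hdisc := hdisc₁.mono (min_le_left R₁ (R₂ / 2))
  set R := min R₁ (R₂ / 2)
  have hR : 2 * R ≤ R₂ := by linarith [min_le_right R₁ (R₂ / 2)]
  have hcont : ContinuousOn (a ∘ e.symm) e.target :=
    ha.continuousOn.comp e.continuousOn_symm e.mapsTo_symm
  have hlim := he.tendstoUniformlyOn_weightedMollify hΩ hμ e.injOn hr0 hR0 hdisc ha.continuousOn
    (hcont.mono ((Metric.closedBall_subset_closedBall hR).trans htarget)) fun z hz =>
      congrArg a (e.left_inv (hr (Metric.ball_subset_closedBall hz)))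
  have hdiff : DifferentiableOn ℂ (a ∘ e.symm) (Metric.ball (e z₀) R) := by
    refine hlim.tendstoLocallyUniformlyOn.differentiableOn ?_ Metric.isOpen_ball
    filter_upwards [tendsto_shrinkingBump_rOut.eventually_lt_const hR0] with n hn
    exact (he.differentiableOn_weightedMollify ha hΩ hdisc hn).const_smul (R := ℝ) _
  exact hdiff.differentiableAt (Metric.ball_mem_nhds _ hR0)

end IsContinuousBeltramiSolution

theorem memL2Loc_of_continuousOn {Ω : Set ℂ} {u : ℂ → ℂ} (hu : ContinuousOn u Ω) :
    MemL2Loc Ω u :=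
  fun _ hK hKΩ => memLp_of_continuousOn_isCompact hK (hu.mono hKΩ)

theorem contDiff_mul_of_tsupport_subset {V : Set ℂ} {χ h : ℂ → ℂ} (hV : IsOpen V)
    (hχ : IsTestFunction V χ) (hh : DifferentiableOn ℂ h V) :
    ContDiff ℝ ∞ (fun w => χ w * h w) := by
  refine contMDiff_iff_contDiff.1 (contMDiff_of_tsupport fun w hw => ?_)
  have hwV : w ∈ V := hχ.2.2 (tsupport_mul_subset_left hw)
  exact contMDiffAt_iff_contDiffAt.2 (hχ.1.contDiffAt.mul
    (((hh.contDiffOn hV).contDiffAt (hV.mem_nhds hwV)).restrict_scalars ℝ))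

theorem SmoothApprox.exists_holomorphic_comp {c : ℂ} {K V : Set ℂ} {F : ℕ → ℂ → ℂ}
    {f p q h : ℂ → ℂ} (hp : SmoothApprox c K F f p) (hq : SmoothApprox (conj c) K F f q)
    (hK : IsCompact K) (hV : IsOpen V) (hfV : MapsTo f K V) (hh : DifferentiableOn ℂ h V) :
    ∃ A, SmoothApprox c K A (h ∘ f) (fun z => deriv h (f z) * p z) := by
  obtain ⟨χ, hχ, hχ1⟩ := exists_isTestFunction_eventuallyEq_one hV
    (hK.image_of_continuousOn hp.continuousOn) hfV.image_subset
  have hlocal (z : ℂ) (hz : z ∈ K) : (fun w => χ w * h w) =ᶠ[𝓝 (f z)] h := by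
    filter_upwards [hχ1 (f z) (mem_image_of_mem f hz)] with w hw
    rw [hw, one_mul]
  refine ⟨_, (hp.comp hq hK (contDiff_mul_of_tsupport_subset hV hχ hh) hχ.2.1.mul_right).congr
    hK.measurableSet (fun z hz => (hlocal z hz).eq_of_nhds) fun z hz => ?_⟩
  have hderiv : HasDerivAt (fun w => χ w * h w) (deriv h (f z)) (f z) :=
    (hh.differentiableAt (hV.mem_nhds (hfV hz))).hasDerivAt.congr_of_eventuallyEq (hlocal z hz)
  simp only [dz_eq_of_hasDerivAt hderiv, dzbar_eq_zero_of_hasDerivAt hderiv, zero_mul, add_zero]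

theorem IsContinuousBeltramiSolution.holomorphic_comp {Ω V : Set ℂ} {μ f p q h : ℂ → ℂ}
    (hf : IsContinuousBeltramiSolution Ω μ f p q) (hΩ : IsOpen Ω) (hV : IsOpen V)
    (hfV : MapsTo f Ω V) (hh : DifferentiableOn ℂ h V) :
    IsContinuousBeltramiSolution Ω μ (h ∘ f) (fun z => deriv h (f z) * p z)
      (fun z => deriv h (f z) * q z) := by
  have hderiv : ContinuousOn (fun z => deriv h (f z)) Ω :=
    (hh.deriv hV).continuousOn.comp hf.continuousOn hfV
  have hmemL2Loc {u : ℂ → ℂ} (hu : MemL2Loc Ω u) : MemL2Loc Ω fun z => deriv h (f z) * u z :=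
    fun K hK hKΩ => memLp_mul_of_continuousOn hK (hderiv.mono hKΩ) (hu K hK hKΩ)
  refine ⟨hh.continuousOn.comp hf.continuousOn hfV, hmemL2Loc hf.memL2Loc_dz,
    hmemL2Loc hf.memL2Loc_dzbar,
    isWeakWirtinger_neg_I.1 (SmoothApprox.isWeakWirtinger hΩ.measurableSet fun K hKΩ hK => ?_),
    isWeakWirtinger_I.1 (SmoothApprox.isWeakWirtinger hΩ.measurableSet fun K hKΩ hK => ?_), ?_⟩
  · obtain ⟨F, hp, hq⟩ := hf.exists_smoothApprox hΩ hK hKΩ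
    exact hp.exists_holomorphic_comp (by simpa using hq) hK hV (hfV.mono_left hKΩ) hh
  · obtain ⟨F, hp, hq⟩ := hf.exists_smoothApprox hΩ hK hKΩ
    exact hq.exists_holomorphic_comp (by simpa using hp) hK hV (hfV.mono_left hKΩ) hh
  · filter_upwards [hf.eq_mul] with z hz
    rw [hz, mul_left_comm]

theorem IsContinuousBeltramiSolution.isBeltramiSolution {Ω : Set ℂ} {μ f p q : ℂ → ℂ}
    (hf : IsContinuousBeltramiSolution Ω μ f p q) : IsBeltramiSolution Ω μ f :=
  ⟨memL2Loc_of_continuousOn hf.continuousOn, p, q, hf.memL2Loc_dz, hf.memL2Loc_dzbar, hf.isWeakDz,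
    hf.isWeakDzbar, hf.eq_mul⟩

theorem IsBeltramiSolution.exists_isContinuousBeltramiSolution {Ω : Set ℂ} {μ f : ℂ → ℂ}
    (hf : IsBeltramiSolution Ω μ f) (hfc : ContinuousOn f Ω) :
    ∃ p q, IsContinuousBeltramiSolution Ω μ f p q := by
  obtain ⟨-, p, q, hp, hq, hdz, hdzbar, hpq⟩ := hf
  exact ⟨p, q, hfc, hp, hq, hdz, hdzbar, hpq⟩

/-! ### Riemann–Stieltjes integrals -/

/-- The points `t 0, …, t n` and tags `s 0, …, s (n - 1)` form a tagged partition of `[0, 1]` of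
mesh less than `δ`. Values at larger indices are irrelevant. -/
structure IsTaggedPartition (δ : ℝ) (n : ℕ) (t s : ℕ → ℝ) : Prop where
  zero : t 0 = 0
  last : t n = 1
  tag_mem : ∀ i < n, s i ∈ Icc (t i) (t (i + 1))
  sub_lt : ∀ i < n, t (i + 1) - t i < δ

namespace IsTaggedPartition

variable {δ ε : ℝ} {n i : ℕ} {s t : ℕ → ℝ}

theorem le (h : IsTaggedPartition δ n t s) (hi : i < n) : t i ≤ t (i + 1) :=
  (h.tag_mem i hi).1.trans (h.tag_mem i hi).2

theorem monotoneOn (h : IsTaggedPartition δ n t s) : MonotoneOn t (Iic n) := by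
  intro i _ j hj hij
  induction j, hij using Nat.le_induction with
  | base => exact le_rfl
  | succ k _ ih => exact (ih (Nat.le_of_succ_le hj)).trans (h.le hj)

theorem mem_Icc (h : IsTaggedPartition δ n t s) (hi : i ≤ n) : t i ∈ Icc (0 : ℝ) 1 :=
  ⟨h.zero.symm.trans_le (h.monotoneOn (Nat.zero_le n) hi (Nat.zero_le i)),
    (h.monotoneOn hi (mem_Iic.2 le_rfl) hi).trans_eq h.last⟩

theorem tag_mem_Icc (h : IsTaggedPartition δ n t s) (hi : i < n) : s i ∈ Icc (0 : ℝ) 1 :=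
  Icc_subset_Icc (h.mem_Icc hi.le).1 (h.mem_Icc hi).2 (h.tag_mem i hi)

theorem mono (h : IsTaggedPartition δ n t s) (hδ : δ ≤ ε) : IsTaggedPartition ε n t s :=
  { h with sub_lt := fun i hi => (h.sub_lt i hi).trans_le hδ }

theorem sum_sub {E : Type*} [AddCommGroup E] (h : IsTaggedPartition δ n t s) (W : ℝ → E) :
    ∑ i ∈ Finset.range n, (W (t (i + 1)) - W (t i)) = W 1 - W 0 := by
  rw [Finset.sum_range_sub fun i => W (t i), h.zero, h.last]

end IsTaggedPartition

theorem exists_isTaggedPartition {δ : ℝ} (hδ : 0 < δ) : ∃ n t, IsTaggedPartition δ n t t := by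
  obtain ⟨n, hn⟩ := exists_nat_one_div_lt hδ
  have hsub (i : ℕ) : ((i + 1 : ℕ) : ℝ) / (n + 1) - i / (n + 1) = 1 / (n + 1) := by
    push_cast
    ring
  refine ⟨n + 1, fun i => i / (n + 1), by simp, ?_, fun i _ => ⟨le_rfl, ?_⟩,
    fun i _ => (hsub i).trans_lt hn⟩
  · push_cast
    exact div_self (by positivity)
  · gcongr
    exact i.le_succ

/-- The Riemann–Stieltjes sum of `u dv` over a tagged partition of `[0, 1]`. -/
noncomputable def stieltjesSum (u v : ℝ → ℂ) (n : ℕ) (t s : ℕ → ℝ) : ℂ :=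
  ∑ i ∈ Finset.range n, u (s i) * (v (t (i + 1)) - v (t i))

/-- The Riemann–Stieltjes integral `∫₀¹ u dv` exists and equals `I`. It is `HasContourIntegral`
with the curve absorbed into the functions, see `hasContourIntegral_iff`. -/
def HasStieltjesIntegral (u v : ℝ → ℂ) (I : ℂ) : Prop :=
  ∀ ε > 0, ∃ δ > 0, ∀ n t s, IsTaggedPartition δ n t s → ‖stieltjesSum u v n t s - I‖ < ε

theorem hasContourIntegral_iff {f g : ℂ → ℂ} {γ : ℝ → ℂ} {I : ℂ} :
    HasContourIntegral f g γ I ↔ HasStieltjesIntegral (f ∘ γ) (g ∘ γ) I := by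
  refine forall₂_congr fun ε _ => exists_congr fun δ => and_congr_right fun _ =>
    forall₃_congr fun n t s => ⟨fun h ht => ?_, fun h h0 hn hts => ?_⟩
  · exact h ht.zero ht.last fun i hi => ⟨ht.tag_mem i hi, ht.sub_lt i hi⟩
  · exact h ⟨h0, hn, fun i hi => (hts i hi).1, fun i hi => (hts i hi).2⟩

namespace HasStieltjesIntegral

variable {u v u' v' : ℝ → ℂ} {I J : ℂ}

theorem unique (hI : HasStieltjesIntegral u v I) (hJ : HasStieltjesIntegral u v J) : I = J := by
  refine eq_of_forall_dist_le fun ε hε => ?_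
  obtain ⟨δ₁, hδ₁, h₁⟩ := hI (ε / 2) (by positivity)
  obtain ⟨δ₂, hδ₂, h₂⟩ := hJ (ε / 2) (by positivity)
  obtain ⟨n, t, ht⟩ := exists_isTaggedPartition (lt_min hδ₁ hδ₂)
  have e₁ := h₁ n t t (ht.mono (min_le_left _ _))
  have e₂ := h₂ n t t (ht.mono (min_le_right _ _))
  rw [← dist_eq_norm] at e₁ e₂
  linarith [dist_triangle_left I J (stieltjesSum u v n t t)]

theorem congr (h : HasStieltjesIntegral u v I) (hu : EqOn u u' (Icc 0 1))
    (hv : EqOn v v' (Icc 0 1)) : HasStieltjesIntegral u' v' I := by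
  intro ε hε
  obtain ⟨δ, hδ, h⟩ := h ε hε
  refine ⟨δ, hδ, fun n t s hts => ?_⟩
  convert h n t s hts using 3
  refine Finset.sum_congr rfl fun i hi => ?_
  have hi := Finset.mem_range.1 hi
  rw [hu (hts.tag_mem_Icc hi), hv (hts.mem_Icc hi), hv (hts.mem_Icc hi.le)]

end HasStieltjesIntegral

theorem hasStieltjesIntegral_of_norm_sub_le {u v W : ℝ → ℂ} {M : ℝ → ℝ}
    (h : ∀ ε > 0, ∃ δ > 0, ∀ x ∈ Icc (0 : ℝ) 1, ∀ y ∈ Icc (0 : ℝ) 1, y - x < δ → ∀ s ∈ Icc x y,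
      ‖u s * (v y - v x) - (W y - W x)‖ ≤ ε * (M y - M x)) :
    HasStieltjesIntegral u v (W 1 - W 0) := by
  intro ε hε
  obtain ⟨δ, hδ, hW⟩ := h (ε / (|M 1 - M 0| + 1)) (by positivity)
  refine ⟨δ, hδ, fun n t s ht => ?_⟩
  rw [stieltjesSum, ← ht.sum_sub W, ← Finset.sum_sub_distrib]
  calc _ ≤ ∑ i ∈ Finset.range n, ε / (|M 1 - M 0| + 1) * (M (t (i + 1)) - M (t i)) := by
        refine norm_sum_le_of_le _ fun i hi => ?_
        have hi := Finset.mem_range.1 hi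
        exact hW _ (ht.mem_Icc hi.le) _ (ht.mem_Icc hi) (ht.sub_lt i hi) _ (ht.tag_mem i hi)
    _ = ε / (|M 1 - M 0| + 1) * (M 1 - M 0) := by rw [← Finset.mul_sum, ht.sum_sub]
    _ < ε := by
        rw [div_mul_eq_mul_div, div_lt_iff₀ (by positivity)]
        nlinarith [le_abs_self (M 1 - M 0)]

theorem sum_norm_le_four_mul_of_forall_subset {ι : Type*} {s : Finset ι} {z : ι → ℂ} {C : ℝ}
    (h : ∀ S ⊆ s, ‖∑ i ∈ S, z i‖ ≤ C) : ∑ i ∈ s, ‖z i‖ ≤ 4 * C := by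
  have key (L : ℂ →+ ℝ) (hL : ∀ w, |L w| ≤ ‖w‖) : ∑ i ∈ s, |L (z i)| ≤ 2 * C := by
    rw [← Finset.sum_filter_add_sum_filter_not s fun i => 0 ≤ L (z i)]
    have hpos : ∑ i ∈ s with 0 ≤ L (z i), |L (z i)| ≤ C := by
      rw [Finset.sum_congr rfl fun i hi => abs_of_nonneg (Finset.mem_filter.1 hi).2, ← map_sum]
      exact (le_abs_self _).trans ((hL _).trans (h _ (Finset.filter_subset _ _)))
    have hneg : ∑ i ∈ s with ¬ 0 ≤ L (z i), |L (z i)| ≤ C := by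
      rw [Finset.sum_congr rfl fun i hi => abs_of_neg (not_le.1 (Finset.mem_filter.1 hi).2),
        Finset.sum_neg_distrib, ← map_sum]
      exact (neg_le_abs _).trans ((hL _).trans (h _ (Finset.filter_subset _ _)))
    linarith
  calc ∑ i ∈ s, ‖z i‖ ≤ ∑ i ∈ s, (|(z i).re| + |(z i).im|) :=
        Finset.sum_le_sum fun i _ => Complex.norm_le_abs_re_add_abs_im _
    _ = ∑ i ∈ s, |(z i).re| + ∑ i ∈ s, |(z i).im| := Finset.sum_add_distrib
    _ ≤ 2 * C + 2 * C := add_le_add (key Complex.reAddGroupHom Complex.abs_re_le_norm)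
        (key Complex.imAddGroupHom Complex.abs_im_le_norm)
    _ = 4 * C := by ring

namespace HasStieltjesIntegral

variable {u v W : ℝ → ℂ} {I : ℂ}

/- Moving the tags of an arbitrary set of intervals from the left to the right end changes the
Riemann–Stieltjes sum by the corresponding part of the sum of `Δu Δv`, and hardly affects it. -/
theorem exists_sum_norm_mul_le (h : HasStieltjesIntegral u v I) {ε : ℝ} (hε : 0 < ε) :
    ∃ δ > 0, ∀ n t, IsTaggedPartition δ n t t →
      ∑ i ∈ Finset.range n, ‖(u (t (i + 1)) - u (t i)) * (v (t (i + 1)) - v (t i))‖ ≤ ε := by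
  classical
  obtain ⟨δ, hδ, h⟩ := h (ε / 8) (by positivity)
  refine ⟨δ, hδ, fun n t ht => ?_⟩
  refine (sum_norm_le_four_mul_of_forall_subset (C := ε / 4) fun S hS => ?_).trans_eq (by ring)
  set s : ℕ → ℝ := fun i => if i ∈ S then t (i + 1) else t i with hs
  have hts : IsTaggedPartition δ n t s := by
    refine { ht with tag_mem := fun i hi => ?_ }
    rw [hs]
    dsimp only
    split_ifs
    exacts [right_mem_Icc.2 (ht.le hi), left_mem_Icc.2 (ht.le hi)]
  have hsum : ∑ i ∈ S, (u (t (i + 1)) - u (t i)) * (v (t (i + 1)) - v (t i)) =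
      stieltjesSum u v n t s - stieltjesSum u v n t t := by
    rw [stieltjesSum, stieltjesSum, ← Finset.sum_sub_distrib, ← Finset.sum_subset hS]
    · exact Finset.sum_congr rfl fun i hi => by rw [hs]; dsimp only; rw [if_pos hi]; ring
    · exact fun i _ hi => by rw [hs]; dsimp only; rw [if_neg hi, sub_self]
  have htags := h n t s hts
  have hleft := h n t t ht
  rw [hsum, ← dist_eq_norm]
  rw [← dist_eq_norm] at htags hleft
  linarith [dist_triangle_right (stieltjesSum u v n t s) (stieltjesSum u v n t t) I]

theorem eq_sub_of_norm_sub_le (h : HasStieltjesIntegral u v I) {C δ : ℝ} (hδ : 0 < δ)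
    (hW : ∀ x ∈ Icc (0 : ℝ) 1, ∀ y ∈ Icc (0 : ℝ) 1, x ≤ y → y - x < δ →
      ‖u x * (v y - v x) - (W y - W x)‖ ≤ C * ‖(u y - u x) * (v y - v x)‖) :
    I = W 1 - W 0 := by
  refine eq_of_forall_dist_le fun ε hε => ?_
  obtain ⟨δ₁, hδ₁, h₁⟩ := h (ε / 2) (by positivity)
  obtain ⟨δ₂, hδ₂, h₂⟩ := h.exists_sum_norm_mul_le (ε := ε / (2 * (|C| + 1))) (by positivity)
  obtain ⟨n, t, ht⟩ := exists_isTaggedPartition (lt_min hδ (lt_min hδ₁ hδ₂))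
  have hI : ‖stieltjesSum u v n t t - I‖ < ε / 2 :=
    h₁ n t t (ht.mono ((min_le_right _ _).trans (min_le_left _ _)))
  have hvar := h₂ n t (ht.mono ((min_le_right _ _).trans (min_le_right _ _)))
  have hdiff : ‖stieltjesSum u v n t t - (W 1 - W 0)‖ ≤ ε / 2 := by
    rw [stieltjesSum, ← ht.sum_sub W, ← Finset.sum_sub_distrib]
    calc _ ≤ ∑ i ∈ Finset.range n,
          (|C| + 1) * ‖(u (t (i + 1)) - u (t i)) * (v (t (i + 1)) - v (t i))‖ := by
          refine norm_sum_le_of_le _ fun i hi => ?_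
          have hi := Finset.mem_range.1 hi
          refine (hW _ (ht.mem_Icc hi.le) _ (ht.mem_Icc hi) (ht.le hi)
            ((ht.sub_lt i hi).trans_le (min_le_left _ _))).trans ?_
          gcongr
          linarith [le_abs_self C]
      _ ≤ (|C| + 1) * (ε / (2 * (|C| + 1))) := by rw [← Finset.mul_sum]; gcongr
      _ = ε / 2 := by field_simp
  rw [← dist_eq_norm] at hI hdiff
  linarith [dist_triangle_left I (W 1 - W 0) (stieltjesSum u v n t t)]

end HasStieltjesIntegral

/-! ### Holomorphic integrands along rough curves -/

section

variable {𝕜 : Type*} [NontriviallyNormedField 𝕜] {H h : 𝕜 → 𝕜} {K : Set 𝕜}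

theorem eventually_forall_norm_mul_sub_sub_le (hK : IsCompact K)
    (hH : ∀ z ∈ K, HasStrictDerivAt H (h z) z) (hh : ∀ z ∈ K, ContinuousAt h z) {ε : ℝ}
    (hε : 0 < ε) :
    ∀ᶠ d : 𝕜 × 𝕜 in 𝓝 0, ∀ z ∈ K,
      ‖h (z + d.1) * d.2 - (H (z + d.2) - H z)‖ ≤ ε * ‖d.2‖ := by
  refine hK.eventually_forall_of_forall_eventually fun z hz => ?_
  have hderiv : ∀ᶠ p : (𝕜 × 𝕜) × 𝕜 in 𝓝 (0, z),
      ‖H (p.2 + p.1.2) - H p.2 - h z * p.1.2‖ ≤ ε / 2 * ‖p.1.2‖ := by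
    have hlim : Tendsto (fun p : (𝕜 × 𝕜) × 𝕜 => (p.2 + p.1.2, p.2)) (𝓝 (0, z)) (𝓝 (z, z)) :=
      Continuous.tendsto' (by fun_prop) _ _ (by simp)
    filter_upwards [hlim.eventually ((hH z hz).isLittleO.bound (half_pos hε))] with p hp
    simpa [mul_comm] using hp
  have hcont : ∀ᶠ p : (𝕜 × 𝕜) × 𝕜 in 𝓝 (0, z), ‖h (p.2 + p.1.1) - h z‖ ≤ ε / 2 := by
    have hlim : Tendsto (fun p : (𝕜 × 𝕜) × 𝕜 => p.2 + p.1.1) (𝓝 (0, z)) (𝓝 z) :=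
      Continuous.tendsto' (by fun_prop) _ _ (by simp)
    filter_upwards [((hh z hz).tendsto.comp hlim).eventually
      (Metric.closedBall_mem_nhds (h z) (half_pos hε))] with p hp
    exact mem_closedBall_iff_norm.1 hp
  filter_upwards [hderiv, hcont] with p h₁ h₂
  calc ‖h (p.2 + p.1.1) * p.1.2 - (H (p.2 + p.1.2) - H p.2)‖
      = ‖(h (p.2 + p.1.1) - h z) * p.1.2 - (H (p.2 + p.1.2) - H p.2 - h z * p.1.2)‖ := by
        congr 1
        ring
    _ ≤ ‖h (p.2 + p.1.1) - h z‖ * ‖p.1.2‖ + ‖H (p.2 + p.1.2) - H p.2 - h z * p.1.2‖ :=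
        (norm_sub_le _ _).trans_eq (by rw [norm_mul])
    _ ≤ ε / 2 * ‖p.1.2‖ + ε / 2 * ‖p.1.2‖ := by gcongr
    _ = ε * ‖p.1.2‖ := by ring

end

section

variable {𝕜 : Type*} [RCLike 𝕜] {H h h' : 𝕜 → 𝕜} {K V : Set 𝕜}

/- Near a point where `h` has derivative `c ≠ 0`, the increments of `h` are comparable with `c`
times those of the argument, so the mean value inequality for `H` gains a factor `‖h b - h a‖`. -/
theorem eventually_forall_norm_mul_sub_sub_le_norm_sub (hK : IsCompact K)
    (hV : IsOpen V) (hKV : K ⊆ V) (hH : ∀ z ∈ V, HasDerivAt H (h z) z)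
    (hh : ∀ z ∈ K, HasStrictDerivAt h (h' z) z) (hne : ∀ z ∈ K, h' z ≠ 0) :
    ∀ᶠ d : 𝕜 in 𝓝 0, ∀ z ∈ K,
      ‖h z * d - (H (z + d) - H z)‖ ≤ 3 * (‖h (z + d) - h z‖ * ‖d‖) := by
  refine hK.eventually_forall_of_forall_eventually fun z hz => ?_
  have hc : 0 < ‖h' z‖ := norm_pos_iff.2 (hne z hz)
  obtain ⟨U, hU, hstrict⟩ := mem_prod_self_iff.1 (nhds_prod_eq (x := z) (y := z) ▸
    (hh z hz).isLittleO.bound (half_pos hc))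
  obtain ⟨r, hr, hball⟩ := Metric.mem_nhds_iff.1 (inter_mem (hV.mem_nhds (hKV hz)) hU)
  have hlim : Tendsto (fun p : 𝕜 × 𝕜 => (p.2, p.2 + p.1)) (𝓝 (0, z)) (𝓝 (z, z)) :=
    Continuous.tendsto' (by fun_prop) _ _ (by simp)
  filter_upwards [hlim.eventually (prod_mem_nhds (Metric.ball_mem_nhds z hr)
    (Metric.ball_mem_nhds z hr))] with p hp
  obtain ⟨d, a⟩ := p
  obtain ⟨ha, hb⟩ : a ∈ Metric.ball z r ∧ a + d ∈ Metric.ball z r := hp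
  have hincr {y : 𝕜} (hy : y ∈ Metric.ball z r) :
      ‖h y - h a - h' z * (y - a)‖ ≤ ‖h' z‖ / 2 * ‖y - a‖ := by
    simpa [mul_comm] using hstrict (mk_mem_prod (hball hy).2 (hball ha).2)
  have hlower : ‖h' z‖ / 2 * ‖d‖ ≤ ‖h (a + d) - h a‖ := by
    have := hincr hb
    rw [add_sub_cancel_left] at this
    have := norm_le_norm_sub_add (h' z * d) (h (a + d) - h a)
    rw [norm_sub_rev, norm_mul] at this
    linarith
  have hupper : ∀ y ∈ segment ℝ a (a + d), ‖h y - h a‖ ≤ 3 * ‖h (a + d) - h a‖ := by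
    intro y hy
    have hle : ‖y - a‖ ≤ ‖d‖ := by simpa using norm_sub_le_of_mem_segment hy
    have := norm_le_norm_sub_add (h y - h a) (h' z * (y - a))
    rw [norm_mul] at this
    have := hincr ((convex_ball z r).segment_subset ha hb hy)
    nlinarith
  have hmean := Convex.norm_image_sub_le_of_norm_hasDerivWithin_le (𝕜 := 𝕜)
    (f := fun y => H y - h a * y) (f' := fun y => h y - h a)
    (fun y hy => (((hH y (hball ((convex_ball z r).segment_subset ha hb hy)).1).sub
      ((hasDerivAt_id' y).const_mul (h a))).congr_deriv (by rw [mul_one])).hasDerivWithinAt)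
    hupper (convex_segment a (a + d)) (left_mem_segment ℝ _ _) (right_mem_segment ℝ _ _)
  rw [add_sub_cancel_left, mul_assoc] at hmean
  refine le_of_eq_of_le ?_ hmean
  rw [norm_sub_rev]
  congr 1
  ring

end

section

variable {V : Set ℂ} {H h : ℂ → ℂ} {Γ : ℝ → ℂ}

theorem differentiableOn_of_hasDerivAt (hV : IsOpen V) (hH : ∀ z ∈ V, HasDerivAt H (h z) z) :
    DifferentiableOn ℂ h V :=
  (DifferentiableOn.deriv (fun z hz => (hH z hz).differentiableAt.differentiableWithinAt)
    hV).congr fun z hz => (hH z hz).deriv.symm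

theorem exists_forall_sub_lt_of_eventually (hΓ : ContinuousOn Γ (Icc 0 1)) {P : ℂ → Prop}
    (hP : ∀ᶠ d in 𝓝 0, P d) :
    ∃ δ > 0, ∀ x ∈ Icc (0 : ℝ) 1, ∀ y ∈ Icc (0 : ℝ) 1, |y - x| < δ → P (Γ y - Γ x) := by
  obtain ⟨ρ, hρ, hball⟩ := Metric.eventually_nhds_iff.1 hP
  obtain ⟨δ, hδ, hunif⟩ := Metric.uniformContinuousOn_iff.1
    (isCompact_Icc.uniformContinuousOn_of_continuous hΓ) ρ hρ
  exact ⟨δ, hδ, fun x hx y hy hxy =>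
    hball (by simpa [dist_eq_norm] using hunif y hy x hx hxy)⟩

theorem norm_sub_le_variationOnFromTo {E : Type*} [SeminormedAddCommGroup E] {f : ℝ → E}
    {s : Set ℝ} (hf : LocallyBoundedVariationOn f s) {x y : ℝ} (hx : x ∈ s) (hy : y ∈ s)
    (hxy : x ≤ y) : ‖f y - f x‖ ≤ variationOnFromTo f s x y := by
  rw [variationOnFromTo.eq_of_le f s hxy, ← dist_eq_norm, dist_edist]
  exact ENNReal.toReal_mono (hf x y hx hy)
    (eVariationOn.edist_le f ⟨hy, hxy, le_rfl⟩ ⟨hx, le_rfl, hxy⟩)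

theorem hasStieltjesIntegral_of_boundedVariationOn (hV : IsOpen V)
    (hH : ∀ z ∈ V, HasDerivAt H (h z) z) (hΓ : ContinuousOn Γ (Icc 0 1))
    (hΓV : MapsTo Γ (Icc 0 1) V) (hbv : BoundedVariationOn Γ (Icc 0 1)) :
    HasStieltjesIntegral (h ∘ Γ) Γ (H (Γ 1) - H (Γ 0)) := by
  have hcont (z) (hz : z ∈ V) : ContinuousAt h z :=
    (differentiableOn_of_hasDerivAt hV hH).continuousOn.continuousAt (hV.mem_nhds hz)
  have hstrict (z) (hz : z ∈ V) : HasStrictDerivAt H (h z) z :=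
    hasStrictDerivAt_of_hasDerivAt_of_continuousAt
      (eventually_of_mem (hV.mem_nhds hz) hH) (hcont z hz)
  have hΓK : Γ '' Icc 0 1 ⊆ V := image_subset_iff.2 hΓV
  refine hasStieltjesIntegral_of_norm_sub_le (W := H ∘ Γ)
    (M := variationOnFromTo Γ (Icc 0 1) 0) fun ε hε => ?_
  have hP := eventually_forall_norm_mul_sub_sub_le (isCompact_Icc.image_of_continuousOn hΓ)
    (fun z hz => hstrict z (hΓK hz)) (fun z hz => hcont z (hΓK hz)) hε
  rw [← Prod.mk_zero_zero, nhds_prod_eq] at hP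
  obtain ⟨p, hp, q, hq, hpq⟩ := eventually_prod_iff.1 hP
  obtain ⟨δ₁, hδ₁, h₁⟩ := exists_forall_sub_lt_of_eventually hΓ hp
  obtain ⟨δ₂, hδ₂, h₂⟩ := exists_forall_sub_lt_of_eventually hΓ hq
  refine ⟨min δ₁ δ₂, lt_min hδ₁ hδ₂, fun x hx y hy hxy s hs => ?_⟩
  have hxs : |s - x| < δ₁ := by
    rw [abs_of_nonneg (sub_nonneg.2 hs.1)]
    linarith [hs.2, hxy.trans_le (min_le_left _ _)]
  have hxy' : |y - x| < δ₂ := by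
    rw [abs_of_nonneg (sub_nonneg.2 (hs.1.trans hs.2))]
    exact hxy.trans_le (min_le_right _ _)
  have hs01 : s ∈ Icc (0 : ℝ) 1 := ⟨hx.1.trans hs.1, hs.2.trans hy.2⟩
  have hest := hpq (h₁ x hx s hs01 hxs) (h₂ x hx y hy hxy') (Γ x) (mem_image_of_mem Γ hx)
  simp only [add_sub_cancel] at hest
  refine hest.trans ?_
  have hlbv := hbv.locallyBoundedVariationOn
  rw [variationOnFromTo.sub_right hlbv (left_mem_Icc.2 zero_le_one) hy hx]
  gcongr
  exact norm_sub_le_variationOnFromTo hlbv hx hy (hs.1.trans hs.2)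

theorem HasStieltjesIntegral.eq_sub_of_injOn (hV : IsOpen V)
    (hH : ∀ z ∈ V, HasDerivAt H (h z) z) (hi : InjOn h V) (hΓ : ContinuousOn Γ (Icc 0 1))
    (hΓV : MapsTo Γ (Icc 0 1) V) {I : ℂ} (hI : HasStieltjesIntegral (h ∘ Γ) Γ I) :
    I = H (Γ 1) - H (Γ 0) := by
  have hh := differentiableOn_of_hasDerivAt hV hH
  have hΓK : Γ '' Icc 0 1 ⊆ V := image_subset_iff.2 hΓV
  have hP := eventually_forall_norm_mul_sub_sub_le_norm_sub
    (isCompact_Icc.image_of_continuousOn hΓ) hV hΓK hH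
    (fun z hz => (hh.analyticAt (hV.mem_nhds (hΓK hz))).hasStrictDerivAt)
    (fun z hz => deriv_ne_zero_of_injOn hV hh hi (hΓK hz))
  obtain ⟨δ, hδ, hloc⟩ := exists_forall_sub_lt_of_eventually hΓ hP
  refine hI.eq_sub_of_norm_sub_le (W := H ∘ Γ) (C := 3) hδ fun x hx y hy hle hxy => ?_
  rw [← abs_of_nonneg (sub_nonneg.2 hle)] at hxy
  simpa using hloc x hx y hy hxy (Γ x) (mem_image_of_mem Γ hx)

end

/-! ### Absolutely continuous curves -/

section

variable {G : ℝ → ℂ} {a b : ℝ}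

theorem absolutelyContinuousOnInterval_lipschitzWith_comp {X Y : Type*} [PseudoMetricSpace X]
    [PseudoMetricSpace Y] {f : ℝ → X} {L : X → Y} {C : ℝ≥0} (hL : LipschitzWith C L)
    (hf : AbsolutelyContinuousOnInterval f a b) : AbsolutelyContinuousOnInterval (L ∘ f) a b := by
  refine squeeze_zero (fun _ => Finset.sum_nonneg fun _ _ => dist_nonneg) (fun E => ?_)
    (by simpa using Tendsto.const_mul (C : ℝ) hf)
  rw [Finset.mul_sum]
  exact Finset.sum_le_sum fun i _ => hL.dist_le_mul _ _

theorem ae_hasDerivAt_of_absolutelyContinuousOnInterval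
    (hG : AbsolutelyContinuousOnInterval G a b) :
    ∀ᵐ t, t ∈ uIcc a b → HasDerivAt G
      ((deriv (Complex.re ∘ G) t : ℝ) + (deriv (Complex.im ∘ G) t : ℝ) * Complex.I) t := by
  have hre : AbsolutelyContinuousOnInterval (Complex.re ∘ G) a b :=
    absolutelyContinuousOnInterval_lipschitzWith_comp Complex.reCLM.lipschitz hG
  have him : AbsolutelyContinuousOnInterval (Complex.im ∘ G) a b :=
    absolutelyContinuousOnInterval_lipschitzWith_comp Complex.imCLM.lipschitz hG
  filter_upwards [hre.ae_differentiableAt, him.ae_differentiableAt] with t h₁ h₂ ht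
  exact ((h₁ ht).hasDerivAt.ofReal_comp.add
    ((h₂ ht).hasDerivAt.ofReal_comp.mul_const Complex.I)).congr_of_eventuallyEq
    (Eventually.of_forall fun s => (Complex.re_add_im _).symm)

theorem hasIntegral_deriv_of_absolutelyContinuousOnInterval
    (hG : AbsolutelyContinuousOnInterval G a b) :
    IntervalIntegrable (deriv G) volume a b ∧ ∫ t in a..b, deriv G t = G b - G a := by
  have hre : AbsolutelyContinuousOnInterval (Complex.re ∘ G) a b :=
    absolutelyContinuousOnInterval_lipschitzWith_comp Complex.reCLM.lipschitz hG
  have him : AbsolutelyContinuousOnInterval (Complex.im ∘ G) a b :=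
    absolutelyContinuousOnInterval_lipschitzWith_comp Complex.imCLM.lipschitz hG
  have hre_int : IntervalIntegrable (fun t => ((deriv (Complex.re ∘ G) t : ℝ) : ℂ)) volume a b :=
    ⟨hre.intervalIntegrable_deriv.1.ofReal, hre.intervalIntegrable_deriv.2.ofReal⟩
  have him_int : IntervalIntegrable (fun t => ((deriv (Complex.im ∘ G) t : ℝ) : ℂ) * Complex.I)
      volume a b :=
    IntervalIntegrable.mul_const
      ⟨him.intervalIntegrable_deriv.1.ofReal, him.intervalIntegrable_deriv.2.ofReal⟩ _
  have hderiv : ∀ᵐ t, t ∈ uIoc a b → ((deriv (Complex.re ∘ G) t : ℝ) : ℂ) +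
      (deriv (Complex.im ∘ G) t : ℝ) * Complex.I = deriv G t := by
    filter_upwards [ae_hasDerivAt_of_absolutelyContinuousOnInterval hG] with t ht hmem
    exact (ht (uIoc_subset_uIcc hmem)).deriv.symm
  refine ⟨(hre_int.add him_int).congr_ae ((ae_restrict_iff' measurableSet_uIoc).2 hderiv), ?_⟩
  rw [← intervalIntegral.integral_congr_ae hderiv, intervalIntegral.integral_add hre_int him_int,
    intervalIntegral.integral_mul_const, intervalIntegral.integral_ofReal,
    intervalIntegral.integral_ofReal, hre.integral_deriv_eq_sub, him.integral_deriv_eq_sub]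
  apply Complex.ext <;> simp

end

section

variable {u v : ℝ → ℂ}

theorem hasStieltjesIntegral_of_absolutelyContinuousOnInterval (hu : ContinuousOn u (Icc 0 1))
    (hv : AbsolutelyContinuousOnInterval v 0 1) :
    IntervalIntegrable (fun t => u t * deriv v t) volume 0 1 ∧
      HasStieltjesIntegral u v (∫ t in (0 : ℝ)..1, u t * deriv v t) := by
  have hv' := (hasIntegral_deriv_of_absolutelyContinuousOnInterval hv).1
  have huv : IntervalIntegrable (fun t => u t * deriv v t) volume 0 1 :=
    hv'.continuousOn_mul (by rwa [uIcc_of_le zero_le_one])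
  refine ⟨huv, ?_⟩
  rw [← sub_zero (∫ t in (0 : ℝ)..1, u t * deriv v t),
    ← intervalIntegral.integral_same (a := 0) (f := fun t => u t * deriv v t)]
  refine hasStieltjesIntegral_of_norm_sub_le (W := fun x => ∫ t in (0 : ℝ)..x, u t * deriv v t)
    (M := fun x => ∫ t in (0 : ℝ)..x, ‖deriv v t‖) fun ε hε => ?_
  obtain ⟨δ, hδ, hunif⟩ := Metric.uniformContinuousOn_iff.1
    (isCompact_Icc.uniformContinuousOn_of_continuous hu) ε hε
  refine ⟨δ, hδ, fun x hx y hy hxy s hs => ?_⟩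
  have hle : x ≤ y := hs.1.trans hs.2
  have hsub {x y : ℝ} (hx : x ∈ Icc (0 : ℝ) 1) (hy : y ∈ Icc (0 : ℝ) 1) :
      uIcc x y ⊆ uIcc (0 : ℝ) 1 := by
    rw [uIcc_of_le zero_le_one]
    exact uIcc_subset_Icc hx hy
  have h0 : (0 : ℝ) ∈ Icc (0 : ℝ) 1 := left_mem_Icc.2 zero_le_one
  have hv'xy := hv'.mono_set (hsub hx hy)
  rw [intervalIntegral.integral_interval_sub_left (huv.mono_set (hsub h0 hy))
      (huv.mono_set (hsub h0 hx)),
    intervalIntegral.integral_interval_sub_left (hv'.norm.mono_set (hsub h0 hy))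
      (hv'.norm.mono_set (hsub h0 hx)),
    ← (hasIntegral_deriv_of_absolutelyContinuousOnInterval (hv.mono (hsub hx hy))).2,
    ← intervalIntegral.integral_const_mul, ← intervalIntegral.integral_sub
      (hv'xy.const_mul _) (huv.mono_set (hsub hx hy)), ← intervalIntegral.integral_const_mul]
  refine intervalIntegral.norm_integral_le_of_norm_le hle
    (Eventually.of_forall fun t ht => ?_) (hv'xy.norm.const_mul _)
  rw [← sub_mul, norm_mul, ← dist_eq_norm]
  gcongr
  refine (hunif _ ⟨hx.1.trans hs.1, hs.2.trans hy.2⟩ _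
    ⟨hx.1.trans ht.1.le, ht.2.trans hy.2⟩ ?_).le
  rw [Real.dist_eq, abs_lt]
  constructor <;> linarith [ht.1, ht.2, hs.1, hs.2]

theorem hasContourIntegral_of_ae_differentiableAt {f g μ : ℂ → ℂ} {γ : ℝ → ℂ}
    (hf : ContinuousOn (f ∘ γ) (Icc 0 1)) (hγ : AbsolutelyContinuousOnInterval γ 0 1)
    (hg : AbsolutelyContinuousOnInterval (g ∘ γ) 0 1)
    (hd : ∀ᵐ t ∂volume.restrict (Icc (0 : ℝ) 1),
      DifferentiableAt ℝ g (γ t) ∧ dzbar g (γ t) = μ (γ t) * dz g (γ t)) :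
    IntervalIntegrable (fun t => f (γ t) * dz g (γ t) *
        (deriv γ t + μ (γ t) * conj (deriv γ t))) volume 0 1 ∧
      HasContourIntegral f g γ (∫ t in (0 : ℝ)..1, f (γ t) * dz g (γ t) *
        (deriv γ t + μ (γ t) * conj (deriv γ t))) := by
  obtain ⟨hint, hI⟩ := hasStieltjesIntegral_of_absolutelyContinuousOnInterval hf hg
  have hchain : ∀ᵐ t, t ∈ uIoc (0 : ℝ) 1 → (f ∘ γ) t * deriv (g ∘ γ) t =
      f (γ t) * dz g (γ t) * (deriv γ t + μ (γ t) * conj (deriv γ t)) := by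
    filter_upwards [(ae_restrict_iff' measurableSet_Icc).1 hd,
      ae_hasDerivAt_of_absolutelyContinuousOnInterval hγ] with t hgt hγt ht
    have ht' : t ∈ uIcc (0 : ℝ) 1 := uIoc_subset_uIcc ht
    obtain ⟨hgd, hgμ⟩ := hgt (by rwa [uIcc_of_le zero_le_one] at ht')
    rw [(hgd.hasFDerivAt.comp_hasDerivAt t (hγt ht').differentiableAt.hasDerivAt).deriv,
      fderiv_apply_eq_dz_mul_add_dzbar_mul, hgμ, Function.comp_apply]
    ring
  refine ⟨hint.congr_ae ((ae_restrict_iff' measurableSet_uIoc).2 hchain), ?_⟩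
  rwa [hasContourIntegral_iff, ← intervalIntegral.integral_congr_ae hchain]

end

/-! ### Morera's theorem -/

/-- The piecewise linear function that increases from `0` to `1` on `[a / 4, (a + 1) / 4]` and
decreases from `1` to `0` on `[(b - 1) / 4, b / 4]`. It serves as a coordinate of
`rectangleCurve`. -/
noncomputable def trapezoid (a b t : ℝ) : ℝ := max 0 (min 1 (min (4 * t - a) (b - 4 * t)))

theorem trapezoid_mem_Icc (a b t : ℝ) : trapezoid a b t ∈ Icc (0 : ℝ) 1 :=
  ⟨le_max_left _ _, max_le zero_le_one (min_le_left _ _)⟩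

theorem lipschitzWith_trapezoid (a b : ℝ) : LipschitzWith 4 (trapezoid a b) := by
  have hup : LipschitzWith 4 fun t : ℝ => 4 * t - a := LipschitzWith.of_dist_le_mul fun s t => by
    simp [Real.dist_eq, ← mul_sub, abs_mul]
  have hdown : LipschitzWith 4 fun t : ℝ => b - 4 * t := LipschitzWith.of_dist_le_mul fun s t => by
    rw [dist_sub_left]
    simp [Real.dist_eq, ← mul_sub, abs_mul]
  have h := ((hup.min hdown).const_min 1).const_max 0
  rwa [max_self] at h

theorem injOn_trapezoid_prodMk :
    InjOn (fun t => (trapezoid 0 3 t, trapezoid 1 4 t)) (Ico 0 1) := by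
  rintro s ⟨hs0, hs1⟩ t ⟨ht0, ht1⟩ hst
  obtain ⟨hx, hy⟩ := Prod.mk.inj hst
  simp only [trapezoid] at hx hy
  grind

theorem trapezoid_of_mem_first {t : ℝ} (ht : t ∈ Icc (0 : ℝ) (1 / 4)) :
    trapezoid 0 3 t = 4 * t ∧ trapezoid 1 4 t = 0 := by
  obtain ⟨h0, h1⟩ := ht
  simp only [trapezoid]
  grind

theorem trapezoid_of_mem_second {t : ℝ} (ht : t ∈ Icc (1 / 4 : ℝ) (1 / 2)) :
    trapezoid 0 3 t = 1 ∧ trapezoid 1 4 t = 4 * t - 1 := by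
  obtain ⟨h0, h1⟩ := ht
  simp only [trapezoid]
  grind

theorem trapezoid_of_mem_third {t : ℝ} (ht : t ∈ Icc (1 / 2 : ℝ) (3 / 4)) :
    trapezoid 0 3 t = 3 - 4 * t ∧ trapezoid 1 4 t = 1 := by
  obtain ⟨h0, h1⟩ := ht
  simp only [trapezoid]
  grind

theorem trapezoid_of_mem_fourth {t : ℝ} (ht : t ∈ Icc (3 / 4 : ℝ) 1) :
    trapezoid 0 3 t = 0 ∧ trapezoid 1 4 t = 4 - 4 * t := by
  obtain ⟨h0, h1⟩ := ht
  simp only [trapezoid]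
  grind

/-- The boundary of the rectangle with opposite corners `z` and `w`, parametrized on `[0, 1]`
starting from `z`, with one side on each quarter of the interval. -/
noncomputable def rectangleCurve (z w : ℂ) (t : ℝ) : ℂ :=
  ⟨z.re + (w.re - z.re) * trapezoid 0 3 t, z.im + (w.im - z.im) * trapezoid 1 4 t⟩

theorem rectangleCurve_mem_rectangle (z w : ℂ) (t : ℝ) :
    rectangleCurve z w t ∈ Complex.Rectangle z w := by
  have hmem (x y : ℝ) {c : ℝ} (hc : c ∈ Icc (0 : ℝ) 1) : x + (y - x) * c ∈ uIcc x y := by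
    rw [← segment_eq_uIcc, segment_eq_image']
    exact ⟨c, hc, by simp [mul_comm]⟩
  exact ⟨hmem _ _ (trapezoid_mem_Icc _ _ _), hmem _ _ (trapezoid_mem_Icc _ _ _)⟩

theorem absolutelyContinuousOnInterval_rectangleCurve (z w : ℂ) (a b : ℝ) :
    AbsolutelyContinuousOnInterval (rectangleCurve z w) a b := by
  have htrap (c d : ℝ) : AbsolutelyContinuousOnInterval (trapezoid c d) a b :=
    (lipschitzWith_trapezoid c d).lipschitzOnWith.absolutelyContinuousOnInterval
  have hline (c d : ℝ) (v : ℂ) :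
      AbsolutelyContinuousOnInterval (fun t => trapezoid c d t • v) a b :=
    absolutelyContinuousOnInterval_lipschitzWith_comp
      (ContinuousLinearMap.toSpanSingleton ℝ v).lipschitz (htrap c d)
  have h := absolutelyContinuousOnInterval_lipschitzWith_comp (isometry_add_left z).lipschitz
    ((hline 0 3 (w.re - z.re : ℝ)).add (hline 1 4 ((w.im - z.im : ℝ) * Complex.I)))
  refine (funext fun t => ?_ : rectangleCurve z w = _) ▸ h
  apply Complex.ext <;> simp [rectangleCurve, mul_comm]

theorem isJordanCurveIn_rectangleCurve {V : Set ℂ} {z w : ℂ} (hre : z.re ≠ w.re)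
    (him : z.im ≠ w.im) (hV : Complex.Rectangle z w ⊆ V) :
    IsJordanCurveIn (rectangleCurve z w) V := by
  refine ⟨?_, ?_, fun s hs t ht hst => ?_, fun t _ => hV (rectangleCurve_mem_rectangle z w t)⟩
  · simpa [uIcc_of_le zero_le_one] using
      (absolutelyContinuousOnInterval_rectangleCurve z w 0 1).continuousOn
  · obtain ⟨h₁, h₂⟩ := trapezoid_of_mem_first (t := 0) (by norm_num)
    obtain ⟨h₃, h₄⟩ := trapezoid_of_mem_fourth (t := 1) (by norm_num)
    simp [rectangleCurve, h₁, h₂, h₃, h₄]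
  · obtain ⟨hst_re, hst_im⟩ := Complex.ext_iff.1 hst
    exact injOn_trapezoid_prodMk hs ht <| Prod.ext
      (mul_left_cancel₀ (sub_ne_zero.2 hre.symm) (add_left_cancel hst_re))
      (mul_left_cancel₀ (sub_ne_zero.2 him.symm) (add_left_cancel hst_im))

theorem integral_comp_mul_deriv_of_eqOn_segment {h : ℂ → ℂ} {Γ : ℝ → ℂ} {a b : ℝ} (hab : a < b)
    (x y : ℝ) (c v : ℂ)
    (hΓ : ∀ t ∈ Icc a b, Γ t = c + (x + (y - x) * ((t - a) / (b - a)) : ℝ) * v) :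
    ∫ t in a..b, h (Γ t) * deriv Γ t = v * ∫ s in x..y, h (c + s * v) := by
  have hba : b - a ≠ 0 := (sub_pos.2 hab).ne'
  set k := (y - x) / (b - a) with hk
  set d := x - k * a with hd
  have hΓ' (t : ℝ) (ht : t ∈ Icc a b) : Γ t = c + (k * t + d : ℝ) * v := by
    rw [hΓ t ht, hd, hk]
    congr 3
    field_simp
    ring
  have hx : k * a + d = x := by ring
  have hy : k * b + d = y := by
    rw [hd, hk]
    field_simp
    ring
  rw [← hx, ← hy, ← intervalIntegral.smul_integral_comp_mul_add (fun s : ℝ => h (c + s * v)),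
    Complex.real_smul, ← mul_assoc, ← intervalIntegral.integral_const_mul]
  refine intervalIntegral.integral_congr_Ioo_of_le hab.le fun t ht => ?_
  have hderiv : HasDerivAt (fun t : ℝ => c + (k * t + d : ℝ) * v) (k * v) t := by
    have hlin := (((hasDerivAt_id t).const_mul k).add_const d).ofReal_comp
    simpa using (hlin.mul_const v).const_add c
  have hev : Γ =ᶠ[𝓝 t] fun t => c + (k * t + d : ℝ) * v := by
    filter_upwards [Ioo_mem_nhds ht.1 ht.2] with s hs using hΓ' s (Ioo_subset_Icc_self hs)
  rw [hev.deriv_eq, hderiv.deriv, hΓ' t (Ioo_subset_Icc_self ht)]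
  ring

section

variable (h : ℂ → ℂ) (z w : ℂ)

theorem integral_rectangleCurve_first :
    ∫ t in 0..1 / 4, h (rectangleCurve z w t) * deriv (rectangleCurve z w) t =
      ∫ x in z.re..w.re, h (x + z.im * Complex.I) := by
  rw [integral_comp_mul_deriv_of_eqOn_segment (by norm_num) z.re w.re (z.im * Complex.I) 1
    fun t ht => ?_]
  · simp only [one_mul, mul_one, add_comm]
  · obtain ⟨h₁, h₂⟩ := trapezoid_of_mem_first ht
    rw [rectangleCurve, Complex.mk_eq_add_mul_I, h₁, h₂]
    push_cast
    ring

theorem integral_rectangleCurve_second :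
    ∫ t in 1 / 4..1 / 2, h (rectangleCurve z w t) * deriv (rectangleCurve z w) t =
      Complex.I * ∫ y in z.im..w.im, h (w.re + y * Complex.I) := by
  refine integral_comp_mul_deriv_of_eqOn_segment (by norm_num) z.im w.im w.re Complex.I
    fun t ht => ?_
  obtain ⟨h₁, h₂⟩ := trapezoid_of_mem_second ht
  rw [rectangleCurve, Complex.mk_eq_add_mul_I, h₁, h₂]
  push_cast
  ring

theorem integral_rectangleCurve_third :
    ∫ t in 1 / 2..3 / 4, h (rectangleCurve z w t) * deriv (rectangleCurve z w) t =
      ∫ x in w.re..z.re, h (x + w.im * Complex.I) := by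
  rw [integral_comp_mul_deriv_of_eqOn_segment (by norm_num) w.re z.re (w.im * Complex.I) 1
    fun t ht => ?_]
  · simp only [one_mul, mul_one, add_comm]
  · obtain ⟨h₁, h₂⟩ := trapezoid_of_mem_third ht
    rw [rectangleCurve, Complex.mk_eq_add_mul_I, h₁, h₂]
    push_cast
    ring

theorem integral_rectangleCurve_fourth :
    ∫ t in 3 / 4..1, h (rectangleCurve z w t) * deriv (rectangleCurve z w) t =
      Complex.I * ∫ y in w.im..z.im, h (z.re + y * Complex.I) := by
  refine integral_comp_mul_deriv_of_eqOn_segment (by norm_num) w.im z.im z.re Complex.I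
    fun t ht => ?_
  obtain ⟨h₁, h₂⟩ := trapezoid_of_mem_fourth ht
  rw [rectangleCurve, Complex.mk_eq_add_mul_I, h₁, h₂]
  push_cast
  ring

end

theorem integral_rectangleCurve {h : ℂ → ℂ} {z w : ℂ}
    (hint : IntervalIntegrable
      (fun t => h (rectangleCurve z w t) * deriv (rectangleCurve z w) t) volume 0 1) :
    ∫ t in 0..1, h (rectangleCurve z w t) * deriv (rectangleCurve z w) t =
      Complex.wedgeIntegral z w h + Complex.wedgeIntegral w z h := by
  have hsub {a b : ℝ} (ha : a ∈ Icc (0 : ℝ) 1 := by norm_num)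
      (hb : b ∈ Icc (0 : ℝ) 1 := by norm_num) : IntervalIntegrable
        (fun t => h (rectangleCurve z w t) * deriv (rectangleCurve z w) t) volume a b :=
    hint.mono_set (by
      rw [uIcc_of_le zero_le_one]
      exact uIcc_subset_Icc ha hb)
  rw [← intervalIntegral.integral_add_adjacent_intervals (hsub (b := 1 / 2)) hsub,
    ← intervalIntegral.integral_add_adjacent_intervals (hsub (b := 1 / 4)) hsub,
    ← intervalIntegral.integral_add_adjacent_intervals (hsub (a := 1 / 2) (b := 3 / 4)) hsub,
    integral_rectangleCurve_first, integral_rectangleCurve_second, integral_rectangleCurve_third,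
    integral_rectangleCurve_fourth]
  rfl

theorem differentiableOn_of_integral_jordanCurve_eq_zero {V : Set ℂ} (hV : IsOpen V) {h : ℂ → ℂ}
    (hh : ContinuousOn h V)
    (hzero : ∀ Γ : ℝ → ℂ, IsJordanCurveIn Γ V → AbsolutelyContinuousOnInterval Γ 0 1 →
      ∫ t in 0..1, h (Γ t) * deriv Γ t = 0) : DifferentiableOn ℂ h V := by
  intro x hx
  obtain ⟨r, hr₀, hr⟩ := Metric.isOpen_iff.1 hV x hx
  have hcons : Complex.IsConservativeOn h (Metric.ball x r) := by
    intro z w hzw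
    rw [← add_eq_zero_iff_eq_neg]
    by_cases hre : z.re = w.re
    · simp [Complex.wedgeIntegral_add_wedgeIntegral_eq, hre]
    by_cases him : z.im = w.im
    · simp [Complex.wedgeIntegral_add_wedgeIntegral_eq, him]
    have hJ := isJordanCurveIn_rectangleCurve hre him (hzw.trans hr)
    have hac := absolutelyContinuousOnInterval_rectangleCurve z w 0 1
    rw [← integral_rectangleCurve (hasStieltjesIntegral_of_absolutelyContinuousOnInterval
      (hh.comp hJ.1 hJ.2.2.2) hac).1]
    exact hzero _ hJ hac
  exact ((hcons.isExactOn_ball (hh.mono hr)).differentiableOn Metric.isOpen_ball).differentiableAt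
    (Metric.ball_mem_nhds x hr₀) |>.differentiableWithinAt

theorem IsJordanCurveIn.comp_of_injOn {V Ω : Set ℂ} {Γ : ℝ → ℂ} {g : ℂ → ℂ}
    (hΓ : IsJordanCurveIn Γ V) (hg : ContinuousOn g V) (hgi : InjOn g V) (hgΩ : MapsTo g V Ω) :
    IsJordanCurveIn (g ∘ Γ) Ω :=
  ⟨hg.comp hΓ.1 hΓ.2.2.2, congrArg g hΓ.2.1,
    hgi.comp hΓ.2.2.1 fun _ ht => hΓ.2.2.2 (Ico_subset_Icc_self ht), hgΩ.comp hΓ.2.2.2⟩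

/-! ### Contour integrals of solutions -/

theorem isSimplyConnected_target {X Y : Type*} [TopologicalSpace X] [TopologicalSpace Y]
    {e : OpenPartialHomeomorph X Y} (he : IsSimplyConnected e.source) :
    IsSimplyConnected e.target :=
  (e.toHomeomorphSourceTarget.toHomotopyEquiv.simplyConnectedSpace_iff).1 he

theorem IsBeltramiSolution.congr {Ω : Set ℂ} {μ f g : ℂ → ℂ} (hΩ : MeasurableSet Ω)
    (hf : IsBeltramiSolution Ω μ f) (hfg : EqOn f g Ω) : IsBeltramiSolution Ω μ g := by
  obtain ⟨hfL2, p, q, hp, hq, hdz, hdzbar, hpq⟩ := hf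
  have hint (u : ℂ → ℂ) : ∫ z in Ω, g z * u z = ∫ z in Ω, f z * u z :=
    setIntegral_congr_fun hΩ fun z hz => congrArg (· * u z) (hfg hz).symm
  refine ⟨fun K hK hKΩ => (memLp_congr_ae ?_).1 (hfL2 K hK hKΩ), p, q, hp, hq,
    fun ψ hψ => (hint _).trans (hdz ψ hψ), fun ψ hψ => (hint _).trans (hdzbar ψ hψ), hpq⟩
  exact (hfg.mono hKΩ).aeEq_restrict hK.measurableSet

namespace IsContinuousBeltramiSolution

variable {e : OpenPartialHomeomorph ℂ ℂ} {μ p q φ : ℂ → ℂ} {γ : ℝ → ℂ}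

theorem isExactOn_comp_symm (he : IsContinuousBeltramiSolution e.source μ e p q)
    (hμ : ∀ᵐ z ∂volume.restrict e.source, ‖μ z‖ < 1) (hsc : IsSimplyConnected e.source)
    (hφc : ContinuousOn φ e.source) (hφ : IsBeltramiSolution e.source μ φ) :
    Complex.IsExactOn (φ ∘ e.symm) e.target := by
  obtain ⟨a, b, hab⟩ := hφ.exists_isContinuousBeltramiSolution hφc
  exact isExactOn_of_isSimplyConnected e.open_target (isSimplyConnected_target hsc)
    (he.differentiableOn_comp_symm hμ hab)

theorem hasContourIntegral_zero_of_boundedVariationOn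
    (he : IsContinuousBeltramiSolution e.source μ e p q)
    (hμ : ∀ᵐ z ∂volume.restrict e.source, ‖μ z‖ < 1) (hsc : IsSimplyConnected e.source)
    (hφc : ContinuousOn φ e.source) (hφ : IsBeltramiSolution e.source μ φ)
    (hγ : IsJordanCurveIn γ e.source) (hbv : BoundedVariationOn (e ∘ γ) (Icc 0 1)) :
    HasContourIntegral φ e γ 0 := by
  obtain ⟨H, hH⟩ := he.isExactOn_comp_symm hμ hsc hφc hφ
  have hI := hasStieltjesIntegral_of_boundedVariationOn e.open_target hH
    (he.continuousOn.comp hγ.1 hγ.2.2.2) (e.mapsTo.comp hγ.2.2.2) hbv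
  rw [Function.comp_apply, Function.comp_apply, hγ.2.1, sub_self] at hI
  exact hasContourIntegral_iff.2 (hI.congr
    (fun t ht => congrArg φ (e.left_inv (hγ.2.2.2 ht))) fun _ _ => rfl)

theorem eq_zero_of_hasContourIntegral (he : IsContinuousBeltramiSolution e.source μ e p q)
    (hμ : ∀ᵐ z ∂volume.restrict e.source, ‖μ z‖ < 1) (hsc : IsSimplyConnected e.source)
    (hφc : ContinuousOn φ e.source) (hφi : InjOn φ e.source)
    (hφ : IsBeltramiSolution e.source μ φ) (hγ : IsJordanCurveIn γ e.source) {I : ℂ}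
    (hI : HasContourIntegral φ e γ I) : I = 0 := by
  obtain ⟨H, hH⟩ := he.isExactOn_comp_symm hμ hsc hφc hφ
  have hI' : HasStieltjesIntegral ((φ ∘ e.symm) ∘ e ∘ γ) (e ∘ γ) I :=
    (hasContourIntegral_iff.1 hI).congr
      (fun t ht => congrArg φ (e.left_inv (hγ.2.2.2 ht)).symm) fun _ _ => rfl
  rw [hI'.eq_sub_of_injOn e.open_target hH (hφi.comp e.symm.injOn e.mapsTo_symm)
    (he.continuousOn.comp hγ.1 hγ.2.2.2) (e.mapsTo.comp hγ.2.2.2),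
    Function.comp_apply, Function.comp_apply, hγ.2.1, sub_self]

theorem isBeltramiSolution_of_hasContourIntegral_eq_zero
    (he : IsContinuousBeltramiSolution e.source μ e p q) (hφc : ContinuousOn φ e.source)
    (hzero : ∀ γ, IsJordanCurveIn γ e.source → BoundedVariationOn (e ∘ γ) (Icc 0 1) →
      ∀ I, HasContourIntegral φ e γ I → I = 0) : IsBeltramiSolution e.source μ φ := by
  have hcont : ContinuousOn (φ ∘ e.symm) e.target := hφc.comp e.continuousOn_symm e.mapsTo_symm
  have hhol : DifferentiableOn ℂ (φ ∘ e.symm) e.target := by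
    refine differentiableOn_of_integral_jordanCurve_eq_zero e.open_target hcont
      fun Γ hΓ hac => ?_
    have hinv : EqOn Γ (e ∘ e.symm ∘ Γ) (Icc 0 1) :=
      fun t ht => (e.right_inv (hΓ.2.2.2 ht)).symm
    refine hzero (e.symm ∘ Γ) (hΓ.comp_of_injOn e.continuousOn_symm e.symm.injOn e.mapsTo_symm)
      ?_ _ (hasContourIntegral_iff.2
        ((hasStieltjesIntegral_of_absolutelyContinuousOnInterval (hcont.comp hΓ.1 hΓ.2.2.2)
          hac).2.congr (fun _ _ => rfl) hinv))
    rw [BoundedVariationOn, ← eVariationOn.congr hinv, ← uIcc_of_le zero_le_one]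
    exact hac.boundedVariationOn
  refine ((he.holomorphic_comp e.open_source e.open_target e.mapsTo hhol).isBeltramiSolution).congr
    e.open_source.measurableSet fun z hz => ?_
  exact congrArg φ (e.left_inv hz)

end IsContinuousBeltramiSolution

theorem ae_norm_lt_one_of_eLpNorm_top_lt_one {α E : Type*} {_ : MeasurableSpace α}
    [NormedAddCommGroup E] {ν : Measure α} {f : α → E} (hf : eLpNorm f ⊤ ν < 1) :
    ∀ᵐ x ∂ν, ‖f x‖ < 1 := by
  rw [eLpNorm_exponent_top] at hf
  filter_upwards [ae_lt_of_essSup_lt hf] with x hx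
  rwa [← ofReal_norm, ENNReal.ofReal_lt_one] at hx

theorem mainTheorem4_general (Ω : Set ℂ) (hΩ : IsOpen Ω) (hΩsc : IsSimplyConnected Ω)
    (μ : ℂ → ℂ) (hμ : ∀ᵐ z ∂volume.restrict Ω, ‖μ z‖ < 1)
    (φ₀ : ℂ → ℂ) (hφ₀c : ContinuousOn φ₀ Ω) (hφ₀i : InjOn φ₀ Ω)
    (hφ₀ : IsBeltramiSolution Ω μ φ₀) (φ : ℂ → ℂ) (hφc : ContinuousOn φ Ω) :
    (IsBeltramiSolution Ω μ φ ↔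
      ∀ γ : ℝ → ℂ, IsJordanCurveIn γ Ω → BoundedVariationOn (φ₀ ∘ γ) (Icc 0 1) →
        HasContourIntegral φ φ₀ γ 0) ∧
    (InjOn φ Ω → (IsBeltramiSolution Ω μ φ ↔
      ∀ γ : ℝ → ℂ, IsJordanCurveIn γ Ω → ∀ I : ℂ, HasContourIntegral φ φ₀ γ I → I = 0)) ∧
    (∀ γ : ℝ → ℂ, IsJordanCurveIn γ Ω →
      AbsolutelyContinuousOnInterval γ 0 1 → AbsolutelyContinuousOnInterval (φ₀ ∘ γ) 0 1 →
      (∀ᵐ t ∂(volume.restrict (Icc (0 : ℝ) 1)),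
        DifferentiableAt ℝ φ₀ (γ t) ∧ dzbar φ₀ (γ t) = μ (γ t) * dz φ₀ (γ t)) →
      IntervalIntegrable (fun t => φ (γ t) * dz φ₀ (γ t) *
        (deriv γ t + μ (γ t) * conj (deriv γ t))) volume 0 1 ∧
      HasContourIntegral φ φ₀ γ (∫ t in (0 : ℝ)..1, φ (γ t) * dz φ₀ (γ t) *
        (deriv γ t + μ (γ t) * conj (deriv γ t)))) := by
  obtain ⟨p, q, hpq⟩ := hφ₀.exists_isContinuousBeltramiSolution hφ₀c
  obtain ⟨e, rfl, rfl⟩ := hpq.exists_openPartialHomeomorph hΩ hμ hφ₀i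
  refine ⟨⟨fun hφ γ hγ hbv => ?_, fun hzero => ?_⟩,
    fun hφi => ⟨fun hφ γ hγ I hI => ?_, fun hzero => ?_⟩, fun γ hγ hac hac₀ hd => ?_⟩
  · exact hpq.hasContourIntegral_zero_of_boundedVariationOn hμ hΩsc hφc hφ hγ hbv
  · exact hpq.isBeltramiSolution_of_hasContourIntegral_eq_zero hφc fun γ hγ hbv I hI =>
      (hasContourIntegral_iff.1 hI).unique (hasContourIntegral_iff.1 (hzero γ hγ hbv))
  · exact hpq.eq_zero_of_hasContourIntegral hμ hΩsc hφc hφi hφ hγ hI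
  · exact hpq.isBeltramiSolution_of_hasContourIntegral_eq_zero hφc
      fun γ hγ _ I hI => hzero γ hγ I hI
  · exact hasContourIntegral_of_ae_differentiableAt (hφc.comp hγ.1 hγ.2.2.2) hac hac₀ hd

theorem mainTheorem4 (Ω : Set ℂ) (hΩ : IsOpen Ω) (hΩsc : IsSimplyConnected Ω)
    (μ : ℂ → ℂ) (hμ : IsPiecewiseContinuousOn μ Ω)
    (hμ1 : eLpNorm μ ⊤ (volume.restrict Ω) < 1)
    (φ₀ : ℂ → ℂ) (hφ₀c : ContinuousOn φ₀ Ω) (hφ₀i : InjOn φ₀ Ω)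
    (hφ₀ : IsBeltramiSolution Ω μ φ₀)
    (φ : ℂ → ℂ) (hφc : ContinuousOn φ Ω) (hφi : InjOn φ Ω) :
    -- vanishing of the contour integral along the Jordan curves with rectifiable image under `φ₀`
    (IsBeltramiSolution Ω μ φ ↔
      ∀ γ : ℝ → ℂ, IsJordanCurveIn γ Ω → BoundedVariationOn (φ₀ ∘ γ) (Icc 0 1) →
        HasContourIntegral φ φ₀ γ 0) ∧
    -- vanishing of the contour integral along all Jordan curves for which it exists
    (IsBeltramiSolution Ω μ φ ↔
      ∀ γ : ℝ → ℂ, IsJordanCurveIn γ Ω → ∀ I : ℂ, HasContourIntegral φ φ₀ γ I → I = 0) ∧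
    -- the contour integral as a line integral, where the integrand of the latter makes sense
    (∀ γ : ℝ → ℂ, IsJordanCurveIn γ Ω →
      AbsolutelyContinuousOnInterval γ 0 1 → AbsolutelyContinuousOnInterval (φ₀ ∘ γ) 0 1 →
      (∀ᵐ t ∂(volume.restrict (Icc (0 : ℝ) 1)),
        DifferentiableAt ℝ φ₀ (γ t) ∧ dzbar φ₀ (γ t) = μ (γ t) * dz φ₀ (γ t)) →
      IntervalIntegrable (fun t => φ (γ t) * dz φ₀ (γ t) *
        (deriv γ t + μ (γ t) * (starRingEnd ℂ) (deriv γ t))) volume 0 1 ∧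
      HasContourIntegral φ φ₀ γ (∫ t in (0 : ℝ)..1, φ (γ t) * dz φ₀ (γ t) *
        (deriv γ t + μ (γ t) * (starRingEnd ℂ) (deriv γ t)))) :=
  have ⟨h₁, h₂, h₃⟩ := mainTheorem4_general Ω hΩ hΩsc μ (ae_norm_lt_one_of_eLpNorm_top_lt_one hμ1)
    φ₀ hφ₀c hφ₀i hφ₀ φ hφc
  ⟨h₁, h₂ hφi, h₃⟩
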